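/- \textbf{Notation.} Let $\mathcal O=\mathbb Z[i]$; the letters $m,n,c,q$ denote non-zero Gaussian integers, and $e[z]=\exp(2\pi i\,\mathrm{Re}\,z)$. For $m,n,c\in\mathcal O$ with $c\neq 0$, let $$S(m,n;c)=\sum_{\alpha\in(\mathcal O/c\mathcal O)^\times}e\Big[\frac{\alpha m+\overline{\alpha}n}{c}\Big],\qquad \alpha\overline\alpha\equiv1\pmod c .$$ Fix a real-valued function $\eta\in C^\infty(0,\infty)$ with $\eta=0$ on $(0,1/2]$ and $\eta=1$ on $[1,\infty)$. For $T\geqslant 1$, let $h(z)=\exp(-|z|^2/T^2)$ and, for $w,v\in\mathbb C$, $$f(w;v)=|w|^2\iint_{\mathbb C}\eta(|z|)\,h(w/z)\,e[-vz]\,\frac{dz}{|z|^4},\qquad \widehat f(u;v)=\iint_{\mathbb C}f(w;v)\,e[-uw]\,dw\quad(v\ne0),$$ where $dz$, $dw$ are Lebesgue measure on $\mathbb C$. Let $a_{(n)}$ be real numbers indexed by the ideals $(n)$ of $\mathcal O$, with $a_{(n)}=0$ unless $N<|n|\leqslant 2N$, and let $\|\boldsymbol a_N\|_2^2=\sum_{N<|n|\leqslant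 2N}|a_{(n)}|^2$. Define the dual sum $$S(\boldsymbol a;X)=\pi^2\sum_{0<|c|\leqslant X}\frac1{|c|^4}\sum_{m}\sum_{n}a_{(m)}a_{(n)}\sum_{q\neq0}S(m,q;c)\,S(n,q;c)\,f\Big(\pi\frac{m-n}{c};\frac qc\Big)$$ and, for $\varepsilon>0$, with $\overline D_\rho=\{u\in\mathbb C:|u|\leqslant\rho\}$, $$S_0(\boldsymbol a;X)=\sum_{0<|c|\leqslant X}\frac1{|c|^4}\sum_{0<|q|\leqslant|c|N^\varepsilon}\ \iint_{\overline D_{N^\varepsilon/T}}\widehat f\Big(\frac u\pi;\frac qc\Big)\bigg|\sum_n a_{(n)}S(n,q;c)\,e\Big[\frac ncu\Big]\bigg|^2du .$$ \textbf{Proposition.} The integral defining $f(w;v)$ converges absolutely, $f(\,\cdot\,;v)$ is integrable on $\mathbb C$ for $v\neq0$, and the series over $q$ in $S(\boldsymbol a;X)$ converges absolutely. For every $\varepsilon>0$ there is a constant, depending only on $\varepsilon$ and $\eta$, such that for all real $1\leqslant X\leqslant T<N$ and all $\boldsymbol a$ as above, with implied constants bounded by it, $$S(\boldsymbol a;X)=S_0(\boldsymbol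 a;X)+O\big(\|\boldsymbol a_N\|_2^2\big),$$ $$S_0(\boldsymbol a;X)\ll T^4N^\varepsilon\sum_{0<|c|\leqslant X}\frac1{|c|^2}\sum_{0<|q|\leqslant|c|N^\varepsilon}\frac1{|q|^2}\iint_{\overline D_{N^\varepsilon/T}}\bigg|\sum_n a_{(n)}S(n,q;c)\,e\Big[\frac ncu\Big]\bigg|^2du,$$ and hence $$S(\boldsymbol a;X)\ll T^4X^2N^\varepsilon\|\boldsymbol a_N\|_2^2 .$$ -/

import Mathlib

namespace DualSum

open MeasureTheory

/-- `e[z] = exp (2 π i Re z)`. -/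
noncomputable def e (z : ℂ) : ℂ :=
  Complex.exp (2 * (Real.pi : ℂ) * Complex.I * (z.re : ℂ))

/-- There are finitely many Gaussian integers in a disc. -/
theorem finite_norm_le (R : ℝ) :
    {n : GaussianInt | ‖GaussianInt.toComplex n‖ ≤ R}.Finite := by
  have hinj : Function.Injective (fun n : GaussianInt => (n.re, n.im)) := by
    intro x y h
    simp only [Prod.mk.injEq] at h
    exact Zsqrtd.ext h.1 h.2
  refine Set.Finite.subset (Set.Finite.preimage hinj.injOn
    ((Set.finite_Icc (-⌈R⌉) ⌈R⌉).prod (Set.finite_Icc (-⌈R⌉) ⌈R⌉))) ?_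
  intro n hn
  have hn' : ‖GaussianInt.toComplex n‖ ≤ R := hn
  have h1 : |(n.re : ℝ)| ≤ R := by
    have := Complex.abs_re_le_norm (GaussianInt.toComplex n)
    rw [← GaussianInt.intCast_re] at this
    exact this.trans hn'
  have h2 : |(n.im : ℝ)| ≤ R := by
    have := Complex.abs_im_le_norm (GaussianInt.toComplex n)
    rw [← GaussianInt.intCast_im] at this
    exact this.trans hn'
  have key : ∀ k : ℤ, |(k : ℝ)| ≤ R → -⌈R⌉ ≤ k ∧ k ≤ ⌈R⌉ := by
    intro k hk
    have hc : |(k : ℝ)| ≤ (⌈R⌉ : ℝ) := hk.trans (Int.le_ceil R)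
    have hk' := abs_le.mp hc
    exact ⟨by exact_mod_cast hk'.1, by exact_mod_cast hk'.2⟩
  simp only [Set.mem_preimage, Set.mem_prod, Set.mem_Icc]
  exact ⟨key _ h1, key _ h2⟩

open Classical in
/-- The Gaussian integers `c` with `0 < |c| ≤ R`. -/
noncomputable def puncturedDisc (R : ℝ) : Finset GaussianInt :=
  (finite_norm_le R).toFinset.filter fun c => c ≠ 0

open Classical in
/-- The Gaussian integers `n` with `N < |n| ≤ 2 N`. -/
noncomputable def annulus (N : ℝ) : Finset GaussianInt :=
  (finite_norm_le (2 * N)).toFinset.filter fun n => N < ‖GaussianInt.toComplex n‖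

/-- The Kloosterman sum `S(m, n; c) = ∑ e[(α m + ᾱ n) / c]` over the invertible residue classes
`α` modulo `c ≠ 0`. Each term is computed from representatives of `α` and of its inverse, and does
not depend on their choice. -/
noncomputable def kloosterman (m n c : GaussianInt) : ℂ :=
  ∑ᶠ α : (GaussianInt ⧸ Ideal.span {c})ˣ,
    e (GaussianInt.toComplex
        (Quotient.out (α : GaussianInt ⧸ Ideal.span {c}) * m +
          Quotient.out ((α⁻¹ : (GaussianInt ⧸ Ideal.span {c})ˣ) : GaussianInt ⧸ Ideal.span {c}) * n)
      / GaussianInt.toComplex c)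

/-- `η` is a smooth real cut-off function on `(0, ∞)`, equal to `0` on `(0, 1/2]` and to `1` on
`[1, ∞)`. Its values outside `(0, ∞)` play no role. -/
structure IsCutoff (η : ℝ → ℝ) : Prop where
  smooth : ContDiffOn ℝ (⊤ : ℕ∞) η (Set.Ioi 0)
  eq_zero : ∀ x : ℝ, 0 < x → x ≤ 1 / 2 → η x = 0
  eq_one : ∀ x : ℝ, 1 ≤ x → η x = 1

/-- The Gaussian weight `h(z) = exp (-|z|² / T²)`. -/
noncomputable def h (T : ℝ) (z : ℂ) : ℝ :=
  Real.exp (-(‖z‖ ^ 2 / T ^ 2))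

/-- The integrand `η(|z|) h(w / z) e[-v z] / |z|⁴`. -/
noncomputable def fIntegrand (η : ℝ → ℝ) (T : ℝ) (w v z : ℂ) : ℂ :=
  ((η ‖z‖ * h T (w / z) / ‖z‖ ^ 4 : ℝ) : ℂ) * e (-(v * z))

/-- `f(w; v) = |w|² ∬ η(|z|) h(w / z) e[-v z] dz / |z|⁴`. -/
noncomputable def f (η : ℝ → ℝ) (T : ℝ) (w v : ℂ) : ℂ :=
  ((‖w‖ ^ 2 : ℝ) : ℂ) * ∫ z : ℂ, fIntegrand η T w v z

/-- The Fourier transform in the first variable, `f̂(u; v) = ∬ f(w; v) e[-u w] dw`. -/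
noncomputable def fHat (η : ℝ → ℝ) (T : ℝ) (u v : ℂ) : ℂ :=
  ∫ w : ℂ, f η T w v * e (-(u * w))

/-- `‖a_N‖₂² = ∑ |a_(n)|²` over the Gaussian integers `N < |n| ≤ 2 N`. -/
noncomputable def normSq (a : Ideal GaussianInt → ℝ) (N : ℝ) : ℝ :=
  ∑ n ∈ annulus N, |a (Ideal.span {n})| ^ 2

/-- The `q`-th term `S(m, q; c) S(n, q; c) f(π (m - n) / c; q / c)` of the dual sum. -/
noncomputable def dualTerm (η : ℝ → ℝ) (T : ℝ) (m n c q : GaussianInt) : ℂ :=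
  kloosterman m q c * kloosterman n q c *
    f η T ((Real.pi : ℂ) * GaussianInt.toComplex (m - n) / GaussianInt.toComplex c)
      (GaussianInt.toComplex q / GaussianInt.toComplex c)

/-- The dual sum `S(a; X)`. -/
noncomputable def S (η : ℝ → ℝ) (T N X : ℝ) (a : Ideal GaussianInt → ℝ) : ℂ :=
  (Real.pi : ℂ) ^ 2 * ∑ c ∈ puncturedDisc X,
    ((1 / ‖GaussianInt.toComplex c‖ ^ 4 : ℝ) : ℂ) *
      ∑ m ∈ annulus N, ∑ n ∈ annulus N,
        (a (Ideal.span {m}) : ℂ) * (a (Ideal.span {n}) : ℂ) *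
          ∑' q : {q : GaussianInt // q ≠ 0}, dualTerm η T m n c q

/-- The twisted exponential sum `∑ₙ a_(n) S(n, q; c) e[n u / c]`. -/
noncomputable def expSum (N : ℝ) (a : Ideal GaussianInt → ℝ) (c q : GaussianInt) (u : ℂ) : ℂ :=
  ∑ n ∈ annulus N, (a (Ideal.span {n}) : ℂ) * kloosterman n q c *
    e (GaussianInt.toComplex n / GaussianInt.toComplex c * u)

/-- `S₀(a; X)`: the Fourier side of the dual sum, cut off at `0 < |q| ≤ |c| N^ε` and
`|u| ≤ N^ε / T`. -/
noncomputable def S₀ (η : ℝ → ℝ) (ε T N X : ℝ) (a : Ideal GaussianInt → ℝ) : ℂ :=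
  ∑ c ∈ puncturedDisc X, ((1 / ‖GaussianInt.toComplex c‖ ^ 4 : ℝ) : ℂ) *
    ∑ q ∈ puncturedDisc (‖GaussianInt.toComplex c‖ * N ^ ε),
      ∫ u in Metric.closedBall (0 : ℂ) (N ^ ε / T),
        fHat η T (u / (Real.pi : ℂ)) (GaussianInt.toComplex q / GaussianInt.toComplex c) *
          ((‖expSum N a c q u‖ ^ 2 : ℝ) : ℂ)

/-- `∑_{|c| ≤ X} |c|⁻² ∑_{0 < |q| ≤ |c| N^ε} |q|⁻² ∬_{|u| ≤ N^ε / T} |∑ₙ a_(n) S(n, q; c) e[n u / c]|² du`. -/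
noncomputable def majorant (ε T N X : ℝ) (a : Ideal GaussianInt → ℝ) : ℝ :=
  ∑ c ∈ puncturedDisc X, 1 / ‖GaussianInt.toComplex c‖ ^ 2 *
    ∑ q ∈ puncturedDisc (‖GaussianInt.toComplex c‖ * N ^ ε),
      1 / ‖GaussianInt.toComplex q‖ ^ 2 *
        ∫ u in Metric.closedBall (0 : ℂ) (N ^ ε / T), ‖expSum N a c q u‖ ^ 2

end DualSum

/-! ### The Fourier transform on `ℂ` for the pairing `Re (u z)` -/

namespace DualSum

open MeasureTheory Complex FourierTransform
open scoped ComplexConjugate Real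

/-! Everything rests on a formula for `f̂`. Put g(w) = |w|² exp(-|w|²). For T = 1, carrying out the
w-integral first gives, formally, f̂(u; v) = ∬ η(|z|) ĝ(u z) e[-v z] dz, the transform at v of z ↦
η(|z|) ĝ(u z). Fubini does not apply directly, since the double integral diverges absolutely at
large z. Writing η = 1 - (1 - η) repairs this. The part with 1 - η has compact support in z and
obeys Fubini. The part with 1 equals Ĝ(v w), where G(z) = |z|⁻⁴ exp(-|z|⁻²); G is flat at 0 and all
its derivatives are O(|z|⁻⁴), so Ĝ is integrable and Fourier inversion applies. The two main terms
match because |u|⁻² g(v/u) = |v|⁻² G(u/v). This is `fHat_one_eq`.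

Integrating by parts k times in z, then rescaling by T, gives `exists_norm_fHat_le`: f̂(u; v) ≪ T⁴
|v|⁻ᵏ (1 + T|u|)⁻ᴬ for every k ≥ 2 and every A.

Inserting Fourier inversion for f into the dual sum separates m from n. As the Kloosterman sums and
the coefficients are real, the double sum becomes a square |∑ aₙ S(n, q; c) e[n u / c]|², and S
becomes S₀ without its truncations (`S_eq_tsum`). Taking k and A large in terms of ε, the tails |q|
> |c| N^ε and |u| > N^ε / T gain N⁻¹², which beats trivial bounds for everything else
(`norm_S_sub_S₀_le`). The case k = 2, A = 0 bounds S₀ by the majorant (`norm_S₀_le`).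

For the majorant, open the Kloosterman sum and apply Cauchy-Schwarz over the units α modulo c. This
bounds the square by 9|c|² ∑ |A((α + u)/c)|², with A(x) = ∑ aₙ e[n x], independently of q.
Integrating over |u| ≤ δ and summing over c leads to integrals of |A|² over discs about reduced
fractions (`large_sieve`). Modulo ℤ[i] a point lies in O((1 + Xδ)²) of these discs
(`card_primitive_le`), and Xδ ≤ N^ε because X ≤ T. -/

theorem e_add (z w : ℂ) : e (z + w) = e z * e w := by
  rw [e, e, e, ← Complex.exp_add]
  congr 1
  push_cast [Complex.add_re]
  ring

theorem norm_e (z : ℂ) : ‖e z‖ = 1 := by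
  rw [e, show (2 * (π : ℂ) * I * (z.re : ℂ)) = ((2 * π * z.re : ℝ) : ℂ) * I by push_cast; ring]
  exact Complex.norm_exp_ofReal_mul_I _

theorem e_neg (z : ℂ) : e (-z) = conj (e z) := by
  rw [e, e, ← Complex.exp_conj]
  congr 1
  simp [map_ofNat]

@[fun_prop]
theorem continuous_e : Continuous e := by
  unfold e
  fun_prop

theorem e_gaussianInt (n : GaussianInt) : e (GaussianInt.toComplex n) = 1 := by
  rw [e, ← GaussianInt.intCast_re, Complex.exp_eq_one_iff]
  exact ⟨n.re, by push_cast; ring⟩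

theorem e_eq_fourierChar (z : ℂ) : e z = (Real.fourierChar z.re : ℂ) := by
  rw [e, Real.fourierChar_apply]
  congr 1
  push_cast
  ring

/-- The Fourier transform for the pairing `Re (u z)` on `ℂ`. -/
noncomputable def fourierC (F : ℂ → ℂ) (u : ℂ) : ℂ := ∫ z : ℂ, F z * e (-(u * z))

/-- The real inner product of `ℂ` is `Re (z conj w)`, so passing to the bilinear pairing conjugates
the frequency. -/
theorem fourierC_eq (F : ℂ → ℂ) (u : ℂ) : fourierC F u = 𝓕 F (conj u) := by
  rw [fourierC, Real.fourier_eq]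
  refine integral_congr_ae (.of_forall fun z => ?_)
  have : (-(u * z)).re = -inner ℝ z (conj u) := by
    simp [Complex.inner, Complex.mul_re]
  simp only [e_eq_fourierChar, this, Circle.smul_def, smul_eq_mul, mul_comm]

theorem integrable_mul_e {F : ℂ → ℂ} (hF : Integrable F) {g : ℂ → ℂ} (hg : Continuous g) :
    Integrable fun z => F z * e (g z) := by
  refine hF.mul_bdd (c := 1) (by fun_prop) (.of_forall fun z => (norm_e _).le)

theorem norm_fourierC_le (F : ℂ → ℂ) (u : ℂ) : ‖fourierC F u‖ ≤ ∫ z, ‖F z‖ := by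
  refine (norm_integral_le_integral_norm _).trans_eq ?_
  simp [norm_e]

theorem continuous_fourierC {F : ℂ → ℂ} (hF : Integrable F) : Continuous (fourierC F) := by
  refine continuous_of_dominated (bound := fun z => ‖F z‖) ?_ ?_ hF.norm ?_
  · exact fun u => (integrable_mul_e hF (by fun_prop)).aestronglyMeasurable
  · exact fun u => .of_forall fun z => by simp [norm_e]
  · exact .of_forall fun z => by fun_prop

theorem map_mul_left_volume {c : ℂ} (hc : c ≠ 0) :
    Measure.map (fun z : ℂ => c * z) volume = ENNReal.ofReal (‖c‖ ^ 2)⁻¹ • volume := by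
  have hdet : LinearMap.det (Algebra.lmul ℝ ℂ c) = ‖c‖ ^ 2 := by
    rw [← Algebra.norm_apply, Algebra.norm_complex_apply, Complex.normSq_eq_norm_sq]
  have := Measure.map_linearMap_addHaar_eq_smul_addHaar (volume : Measure ℂ)
    (f := Algebra.lmul ℝ ℂ c) (by rw [hdet]; positivity)
  rw [hdet, abs_of_nonneg (by positivity)] at this
  exact this

theorem measurableEmbedding_mul_left {c : ℂ} (hc : c ≠ 0) :
    MeasurableEmbedding fun z : ℂ => c * z :=
  (Homeomorph.mulLeft₀ c hc).measurableEmbedding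

theorem integral_comp_mul_left {E : Type*} [NormedAddCommGroup E] [NormedSpace ℝ E]
    (F : ℂ → E) {c : ℂ} (hc : c ≠ 0) : ∫ z, F (c * z) = (‖c‖ ^ 2)⁻¹ • ∫ z, F z := by
  rw [← (measurableEmbedding_mul_left hc).integral_map, map_mul_left_volume hc,
    integral_smul_measure, ENNReal.toReal_ofReal (by positivity)]

theorem lintegral_comp_mul_left (F : ℂ → ENNReal) {c : ℂ} (hc : c ≠ 0) :
    ∫⁻ z, F (c * z) = ENNReal.ofReal (‖c‖ ^ 2)⁻¹ * ∫⁻ z, F z := by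
  rw [← (measurableEmbedding_mul_left hc).lintegral_map, map_mul_left_volume hc,
    lintegral_smul_measure, smul_eq_mul]

theorem integrable_comp_mul_left {E : Type*} [NormedAddCommGroup E]
    {F : ℂ → E} (hF : Integrable F) {c : ℂ} (hc : c ≠ 0) : Integrable fun z => F (c * z) := by
  refine ((measurableEmbedding_mul_left hc).integrable_map_iff (g := F)).1 ?_
  rw [map_mul_left_volume hc]
  exact hF.smul_measure ENNReal.ofReal_ne_top

theorem fourierC_comp_mul (F : ℂ → ℂ) {c : ℂ} (hc : c ≠ 0) (u : ℂ) :
    fourierC (fun z => F (c * z)) u = ((‖c‖ ^ 2)⁻¹ : ℝ) * fourierC F (u / c) := by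
  have := integral_comp_mul_left (fun z => F z * e (-(u / c * z))) hc
  rw [Complex.real_smul] at this
  rw [fourierC, fourierC, ← this]
  refine integral_congr_ae (.of_forall fun z => ?_)
  simp only
  congr 3
  field_simp

theorem measurePreserving_conj : MeasurePreserving (fun z : ℂ => conj z) :=
  Complex.conjLIE.measurePreserving

theorem integrable_fourier_iff (F : ℂ → ℂ) : Integrable (𝓕 F) ↔ Integrable (fourierC F) := by
  have h : fourierC F = 𝓕 F ∘ fun z => conj z := funext fun u => fourierC_eq F u
  rw [h, measurePreserving_conj.integrable_comp_emb Complex.conjLIE.toHomeomorph.measurableEmbedding]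

/-- Fourier inversion. -/
theorem fourierC_fourierC {F : ℂ → ℂ} (hc : Continuous F) (hF : Integrable F)
    (hF' : Integrable (fourierC F)) (z : ℂ) : fourierC (fourierC F) z = F (-z) := by
  have h1 := congrFun (hc.fourierInv_fourier_eq hF ((integrable_fourier_iff F).2 hF')) (-z)
  rw [← h1, Real.fourierInv_eq_fourier_neg, neg_neg, fourierC_eq]
  have h : fourierC F = 𝓕 F ∘ Complex.conjLIE := funext fun u => fourierC_eq F u
  rw [h, Real.fourier_comp_linearIsometry]
  simp

/-! ### Functions flat at the origin and the integrability of their transforms -/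

/-- The function `(Re z)^a (Im z)^b |z|^(-2m) exp (-1 / |z|²)`. -/
noncomputable def flat (a b m : ℕ) (z : ℂ) : ℝ :=
  z.re ^ a * z.im ^ b * ((Complex.normSq z)⁻¹ ^ m * expNegInvGlue (Complex.normSq z))

/-- Outside the unit disc the exponential is at most 1 and the hypothesis on the exponents gives the
decay. Inside, t^m ≤ m! exp t with t = |z|⁻² absorbs the pole. -/
theorem abs_flat_le {a b m : ℕ} (h : a + b + 4 ≤ 2 * m) (z : ℂ) :
    |flat a b m z| ≤ 16 * m.factorial * (1 + ‖z‖) ^ (-4 : ℝ) := by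
  have hmf : (1 : ℝ) ≤ m.factorial := by exact_mod_cast Nat.one_le_iff_ne_zero.2 m.factorial_ne_zero
  have key : ‖z‖ ^ (a + b) * ((Complex.normSq z)⁻¹ ^ m * expNegInvGlue (Complex.normSq z)) * (1 + ‖z‖) ^ 4 ≤
      16 * m.factorial := by
    rcases eq_or_ne z 0 with rfl | hz
    · simp [expNegInvGlue.zero]
    have hz' : 0 < ‖z‖ := norm_pos_iff.2 hz
    have hpos : 0 < Complex.normSq z := normSq_pos.2 hz
    rcases le_total 1 ‖z‖ with h1 | h1
    · have hE : expNegInvGlue (Complex.normSq z) ≤ 1 := by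
        rw [expNegInvGlue, if_neg (not_le.2 hpos)]
        exact Real.exp_le_one_iff.2 (by simpa using hpos.le)
      have h2 : (1 + ‖z‖) ^ 4 ≤ 16 * ‖z‖ ^ 4 := by
        calc (1 + ‖z‖) ^ 4 ≤ (2 * ‖z‖) ^ 4 := by gcongr; linarith
          _ = _ := by ring
      have h3 : ‖z‖ ^ (a + b) * ‖z‖ ^ 4 ≤ Complex.normSq z ^ m := by
        rw [normSq_eq_norm_sq, ← pow_mul, ← pow_add]
        exact pow_le_pow_right₀ h1 h
      calc ‖z‖ ^ (a + b) * ((Complex.normSq z)⁻¹ ^ m * expNegInvGlue (Complex.normSq z)) * (1 + ‖z‖) ^ 4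
          ≤ ‖z‖ ^ (a + b) * ((Complex.normSq z)⁻¹ ^ m * 1) * (16 * ‖z‖ ^ 4) := by gcongr
        _ = 16 * ((‖z‖ ^ (a + b) * ‖z‖ ^ 4) * ((Complex.normSq z) ^ m)⁻¹) := by rw [inv_pow]; ring
        _ ≤ 16 * (Complex.normSq z ^ m * ((Complex.normSq z) ^ m)⁻¹) := by gcongr
        _ = 16 * 1 := by rw [mul_inv_cancel₀ (by positivity)]
        _ ≤ _ := by gcongr
    · have hE : (Complex.normSq z)⁻¹ ^ m * expNegInvGlue (Complex.normSq z) ≤ m.factorial := by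
        rw [expNegInvGlue, if_neg (not_le.2 hpos), Real.exp_neg]
        have := Real.pow_div_factorial_le_exp (Complex.normSq z)⁻¹ (by positivity) m
        rw [div_le_iff₀ (by positivity)] at this
        rw [← div_eq_mul_inv, div_le_iff₀ (by positivity), mul_comm]
        exact this
      calc ‖z‖ ^ (a + b) * ((Complex.normSq z)⁻¹ ^ m * expNegInvGlue (Complex.normSq z)) * (1 + ‖z‖) ^ 4
          ≤ 1 * m.factorial * (1 + 1) ^ 4 := by
            gcongr
            · exact mul_nonneg (pow_nonneg (inv_nonneg.2 hpos.le) m) (expNegInvGlue.nonneg _)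
            · exact pow_le_one₀ hz'.le h1
        _ = _ := by ring
  have hr : (1 + ‖z‖) ^ (-4 : ℝ) = ((1 + ‖z‖) ^ 4)⁻¹ := by
    rw [Real.rpow_neg (by positivity)]
    norm_cast
  rw [hr, ← div_eq_mul_inv, le_div_iff₀ (by positivity)]
  refine le_trans ?_ key
  rw [flat, abs_mul, abs_mul, abs_pow, abs_pow, abs_of_nonneg
    (mul_nonneg (pow_nonneg (inv_nonneg.2 (normSq_nonneg z)) m) (expNegInvGlue.nonneg _)), pow_add]
  have := expNegInvGlue.nonneg (Complex.normSq z)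
  have h0 := normSq_nonneg z
  gcongr
  · exact Complex.abs_re_le_norm z
  · exact Complex.abs_im_le_norm z

theorem hasFDerivAt_flat (a b m : ℕ) (z : ℂ) :
    HasFDerivAt (flat a b m)
      ((a * flat (a - 1) b m z - 2 * m * flat (a + 1) b (m + 1) z
          + 2 * flat (a + 1) b (m + 2) z) • reCLM +
        (b * flat a (b - 1) m z - 2 * m * flat a (b + 1) (m + 1) z
          + 2 * flat a (b + 1) (m + 2) z) • imCLM) z := by
  have h1 : HasFDerivAt (fun z : ℂ => z.re) reCLM z := reCLM.hasFDerivAt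
  have h2 : HasFDerivAt (fun z : ℂ => z.im) imCLM z := imCLM.hasFDerivAt
  have h3 : HasFDerivAt (fun z : ℂ => Complex.normSq z) ((2 * z.re) • reCLM + (2 * z.im) • imCLM) z := by
    have := (h1.mul h1).add (h2.mul h2)
    refine (this.congr_of_eventuallyEq (.of_forall fun w => normSq_apply w)).congr_fderiv ?_
    ext
    all_goals
      simp
      ring
  have h4 := (expNegInvGlue.hasDerivAt_polynomial_eval_inv_mul (Polynomial.X ^ m)
    (Complex.normSq z)).comp_hasFDerivAt z h3
  have h5 := ((h1.pow a).mul (h2.pow b)).mul h4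
  refine (h5.congr_of_eventuallyEq (.of_forall fun w => ?_)).congr_fderiv ?_
  · simp [flat]
  -- The derivative of X^m brings in the truncated exponent m - 1; at m = 0 its coefficient
  -- vanishes, so the identity holds for every m. The exponents a - 1 and b - 1 are harmless for the
  -- same reason.
  · have hp : (m : ℝ) * (Complex.normSq z)⁻¹ ^ (m - 1) * ((Complex.normSq z)⁻¹) ^ 2 = m * (Complex.normSq z)⁻¹ ^ (m + 1) := by
      rcases m with _ | m
      · simp
      · rw [mul_assoc, ← pow_add]
        rfl
    refine ContinuousLinearMap.ext fun w => ?_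
    simp [flat, Polynomial.derivative_X_pow]
    linear_combination (-2 * (z.re * w.re + z.im * w.im) * z.re ^ a * z.im ^ b *
      expNegInvGlue (Complex.normSq z)) * hp

/-- The span of the functions `flat a b m` that are `O (|z|⁻⁴)`. -/
noncomputable def flatSpan : Submodule ℝ (ℂ → ℝ) :=
  Submodule.span ℝ {F | ∃ a b m : ℕ, a + b + 4 ≤ 2 * m ∧ F = flat a b m}

theorem flat_mem_flatSpan {a b m : ℕ} (h : a + b + 4 ≤ 2 * m) : flat a b m ∈ flatSpan :=
  Submodule.subset_span ⟨a, b, m, h, rfl⟩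

theorem exists_bound_of_mem_flatSpan {F : ℂ → ℝ} (hF : F ∈ flatSpan) :
    ∃ C, ∀ z, |F z| ≤ C * (1 + ‖z‖) ^ (-4 : ℝ) := by
  refine Submodule.span_induction ?_ ?_ ?_ ?_ hF
  · rintro _ ⟨a, b, m, h, rfl⟩
    exact ⟨_, abs_flat_le h⟩
  · exact ⟨0, fun z => by simp⟩
  · rintro F G - - ⟨C, hC⟩ ⟨D, hD⟩
    refine ⟨C + D, fun z => (abs_add_le _ _).trans ?_⟩
    rw [add_mul]
    exact add_le_add (hC z) (hD z)
  · rintro c F - ⟨C, hC⟩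
    refine ⟨|c| * C, fun z => ?_⟩
    rw [Pi.smul_apply, smul_eq_mul, abs_mul, mul_assoc]
    exact mul_le_mul_of_nonneg_left (hC z) (abs_nonneg c)

/-- A partial derivative either lowers a numerator exponent, or raises one by 1 while raising m by 1
or 2. Each move preserves a + b + 4 ≤ 2m, so the decay O(|z|⁻⁴) survives any number of
differentiations. -/
theorem exists_fderiv_of_mem_flatSpan {F : ℂ → ℝ} (hF : F ∈ flatSpan) :
    ∃ G ∈ flatSpan, ∃ H ∈ flatSpan, ∀ z, HasFDerivAt F (G z • reCLM + H z • imCLM) z := by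
  refine Submodule.span_induction ?_ ?_ ?_ ?_ hF
  · rintro _ ⟨a, b, m, h, rfl⟩
    refine ⟨(a : ℝ) • flat (a - 1) b m - (2 * m : ℝ) • flat (a + 1) b (m + 1)
      + (2 : ℝ) • flat (a + 1) b (m + 2), ?_,
      (b : ℝ) • flat a (b - 1) m - (2 * m : ℝ) • flat a (b + 1) (m + 1)
      + (2 : ℝ) • flat a (b + 1) (m + 2), ?_, fun z => hasFDerivAt_flat a b m z⟩
    all_goals
      refine add_mem (sub_mem (Submodule.smul_mem _ _ (flat_mem_flatSpan ?_))
        (Submodule.smul_mem _ _ (flat_mem_flatSpan ?_)))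
        (Submodule.smul_mem _ _ (flat_mem_flatSpan ?_)) <;> omega
  · exact ⟨0, zero_mem _, 0, zero_mem _, fun z =>
      (hasFDerivAt_const (0 : ℝ) z).congr_fderiv (by simp)⟩
  · rintro F F' - - ⟨G, hG, H, hH, h⟩ ⟨G', hG', H', hH', h'⟩
    refine ⟨G + G', add_mem hG hG', H + H', add_mem hH hH', fun z => ?_⟩
    refine ((h z).add (h' z)).congr_fderiv ?_
    simp only [Pi.add_apply, add_smul]
    abel
  · rintro c F - ⟨G, hG, H, hH, h⟩
    refine ⟨c • G, Submodule.smul_mem _ _ hG, c • H, Submodule.smul_mem _ _ hH, fun z => ?_⟩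
    refine ((h z).const_smul c).congr_fderiv ?_
    simp only [Pi.smul_apply, smul_add, smul_smul, smul_eq_mul]

theorem continuous_of_mem_flatSpan {F : ℂ → ℝ} (hF : F ∈ flatSpan) : Continuous F := by
  obtain ⟨G, -, H, -, h⟩ := exists_fderiv_of_mem_flatSpan hF
  exact continuous_iff_continuousAt.2 fun z => (h z).continuousAt

theorem integrable_of_mem_flatSpan {F : ℂ → ℝ} (hF : F ∈ flatSpan) : Integrable F := by
  obtain ⟨C, hC⟩ := exists_bound_of_mem_flatSpan hF
  refine ((integrable_one_add_norm (E := ℂ) (μ := volume) (r := 4) ?_).const_mul C).mono'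
    (continuous_of_mem_flatSpan hF).aestronglyMeasurable (.of_forall hC)
  rw [Complex.finrank_real_complex]
  norm_num

/-- One integration by parts: differentiation along 1 or `I` multiplies the transform by a factor of
modulus 2π|Re u| or 2π|Im u|, and 2π ≥ 1 is discarded. -/
theorem fourierC_fderiv_of_mem_flatSpan {F : ℂ → ℝ} (hF : F ∈ flatSpan) :
    ∃ G ∈ flatSpan, ∃ H ∈ flatSpan, ∀ u : ℂ,
      |u.re| * ‖fourierC (fun z => F z) u‖ ≤ ‖fourierC (fun z => G z) u‖ ∧
      |u.im| * ‖fourierC (fun z => F z) u‖ ≤ ‖fourierC (fun z => H z) u‖ := by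
  obtain ⟨G, hG, H, hH, h⟩ := exists_fderiv_of_mem_flatSpan hF
  refine ⟨G, hG, H, hH, fun u => ?_⟩
  have hd : ∀ z, HasFDerivAt (fun z => (F z : ℂ)) (ofRealCLM ∘L (G z • reCLM + H z • imCLM)) z :=
    fun z => ofRealCLM.hasFDerivAt.comp z (h z)
  have hfd : fderiv ℝ (fun z => (F z : ℂ)) =
      fun z => ofRealCLM ∘L (G z • reCLM + H z • imCLM) := funext fun z => (hd z).fderiv
  have hGi := integrable_of_mem_flatSpan hG
  have hHi := integrable_of_mem_flatSpan hH
  have hint : Integrable (fderiv ℝ fun z => (F z : ℂ)) := by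
    rw [hfd]
    exact (ContinuousLinearMap.compL ℝ ℂ ℝ ℂ ofRealCLM).integrable_comp
      ((hGi.smul_const _).add (hHi.smul_const _))
  have key := congrFun (Real.fourier_fderiv (integrable_of_mem_flatSpan hF).ofReal
    (fun z => (hd z).differentiableAt) hint) (conj u)
  have hev : ∀ m : ℂ, 𝓕 (fderiv ℝ fun z => (F z : ℂ)) (conj u) m =
      fourierC (fun z => fderiv ℝ (fun z => (F z : ℂ)) z m) u := by
    intro m
    rw [fourierC_eq, Real.fourier_eq, Real.fourier_eq, ContinuousLinearMap.integral_apply]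
    · rfl
    · simpa using (Real.fourierIntegral_convergent_iff (conj u)).2 hint
  have hpi : (1 : ℝ) ≤ 2 * π := by linarith [Real.pi_gt_three]
  constructor
  · have h1 := hev 1
    rw [key] at h1
    simp only [hfd] at h1
    simp only [VectorFourier.fourierSMulRight_apply, ← fourierC_eq] at h1
    simp at h1
    have hi : innerSL ℝ (conj u) 1 = u.re := by
      change inner ℝ (conj u) 1 = _
      simp [Complex.inner]
    rw [← h1, hi]
    simp [abs_of_pos Real.pi_pos]
    nlinarith [mul_nonneg (abs_nonneg u.re) (norm_nonneg (fourierC (fun z => F z) u))]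
  · have h1 := hev I
    rw [key] at h1
    simp only [hfd] at h1
    simp only [VectorFourier.fourierSMulRight_apply, ← fourierC_eq] at h1
    simp at h1
    have hi : innerSL ℝ (conj u) I = -u.im := by
      change inner ℝ (conj u) I = _
      simp [Complex.inner]
    rw [← h1, hi]
    simp [abs_of_pos Real.pi_pos]
    nlinarith [mul_nonneg (abs_nonneg u.im) (norm_nonneg (fourierC (fun z => F z) u))]

theorem exists_pow_mul_norm_fourierC_le {F : ℂ → ℝ} (hF : F ∈ flatSpan) (n : ℕ) :
    ∃ C, ∀ u : ℂ, |u.re| ^ n * ‖fourierC (fun z => F z) u‖ ≤ C ∧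
      |u.im| ^ n * ‖fourierC (fun z => F z) u‖ ≤ C := by
  induction n generalizing F with
  | zero => exact ⟨_, fun u => by simpa using norm_fourierC_le (fun z => F z) u⟩
  | succ n ih =>
    obtain ⟨G, hG, H, hH, h⟩ := fourierC_fderiv_of_mem_flatSpan hF
    obtain ⟨C, hC⟩ := ih hG
    obtain ⟨D, hD⟩ := ih hH
    refine ⟨max C D, fun u => ⟨?_, ?_⟩⟩
    · rw [pow_succ, mul_assoc]
      exact (mul_le_mul_of_nonneg_left (h u).1 (by positivity)).trans
        ((hC u).1.trans (le_max_left _ _))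
    · rw [pow_succ, mul_assoc]
      exact (mul_le_mul_of_nonneg_left (h u).2 (by positivity)).trans
        ((hD u).2.trans (le_max_right _ _))

/-- Four integrations by parts give decay (1 + |u|)⁻⁴, integrable on the plane. For `invGauss`,
which is not a Schwartz function, this supplies both Fourier inversion and the integrability in w of
the main part of f(w; v). -/
theorem integrable_fourierC_of_mem_flatSpan {F : ℂ → ℝ} (hF : F ∈ flatSpan) :
    Integrable (fourierC fun z => F z) := by
  obtain ⟨C, hC⟩ := exists_pow_mul_norm_fourierC_le hF 4
  obtain ⟨D, hD⟩ := exists_pow_mul_norm_fourierC_le hF 0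
  refine ((integrable_one_add_norm (E := ℂ) (μ := volume) (r := 4) ?_).const_mul
    (81 * (D + C + C))).mono' (continuous_fourierC
      (integrable_of_mem_flatSpan hF).ofReal).aestronglyMeasurable (.of_forall fun u => ?_)
  · rw [Complex.finrank_real_complex]
    norm_num
  have hr : (1 + ‖u‖) ^ (-4 : ℝ) = ((1 + ‖u‖) ^ 4)⁻¹ := by
    rw [Real.rpow_neg (by positivity)]
    norm_cast
  rw [hr, ← div_eq_mul_inv, le_div_iff₀ (by positivity)]
  have h1 : (1 + ‖u‖) ^ 4 ≤ 81 * (1 + |u.re| ^ 4 + |u.im| ^ 4) := by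
    have hu := Complex.norm_le_abs_re_add_abs_im u
    have : ∀ x y : ℝ, (1 + x + y) ^ 4 ≤ 81 * (1 + x ^ 4 + y ^ 4) := fun x y => by
      have h2 : (1 + x + y) ^ 2 ≤ 3 * (1 + x ^ 2 + y ^ 2) := by
        nlinarith [sq_nonneg (1 - x), sq_nonneg (1 - y), sq_nonneg (x - y)]
      have h3 : (1 + x ^ 2 + y ^ 2) ^ 2 ≤ 3 * (1 + x ^ 4 + y ^ 4) := by
        nlinarith [sq_nonneg (1 - x ^ 2), sq_nonneg (1 - y ^ 2), sq_nonneg (x ^ 2 - y ^ 2)]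
      nlinarith [pow_le_pow_left₀ (sq_nonneg (1 + x + y)) h2 2, sq_nonneg (x ^ 2), sq_nonneg (y ^ 2)]
    refine le_trans ?_ (this _ _)
    exact pow_le_pow_left₀ (by positivity) (by linarith) 4
  have h2 := hC u
  have h3 := (hD u).1
  rw [pow_zero, one_mul] at h3
  calc ‖fourierC (fun z => F z) u‖ * (1 + ‖u‖) ^ 4
      ≤ ‖fourierC (fun z => F z) u‖ * (81 * (1 + |u.re| ^ 4 + |u.im| ^ 4)) := by gcongr
    _ ≤ _ := by linarith

/-- The function `|z|⁻⁴ exp (-|z|⁻²)`. -/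
noncomputable def invGauss (z : ℂ) : ℂ := (Real.exp (-(‖z‖ ^ 2)⁻¹) / ‖z‖ ^ 4 : ℝ)

theorem invGauss_eq (z : ℂ) : invGauss z = flat 0 0 2 z := by
  rcases eq_or_ne z 0 with rfl | hz
  · simp [invGauss, flat, expNegInvGlue.zero]
  · rw [invGauss, flat, expNegInvGlue, if_neg (not_le.2 (Complex.normSq_pos.2 hz)),
      Complex.normSq_eq_norm_sq]
    congr 1
    ring

theorem invGauss_neg (z : ℂ) : invGauss (-z) = invGauss z := by simp [invGauss]

theorem continuous_invGauss : Continuous invGauss := by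
  rw [funext invGauss_eq]
  exact continuous_ofReal.comp (continuous_of_mem_flatSpan (flat_mem_flatSpan (by norm_num)))

theorem integrable_invGauss : Integrable invGauss := by
  rw [funext invGauss_eq]
  exact (integrable_of_mem_flatSpan (flat_mem_flatSpan (by norm_num))).ofReal

theorem integrable_fourierC_invGauss : Integrable (fourierC invGauss) := by
  rw [funext invGauss_eq]
  exact integrable_fourierC_of_mem_flatSpan (flat_mem_flatSpan (by norm_num))

theorem fourierC_fourierC_invGauss (z : ℂ) : fourierC (fourierC invGauss) z = invGauss z := by
  rw [fourierC_fourierC continuous_invGauss integrable_invGauss integrable_fourierC_invGauss,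
    invGauss_neg]

end DualSum

/-! ### Schwartz functions: the Gaussian, its transform, and the cut-off -/

namespace DualSum

open MeasureTheory Complex FourierTransform SchwartzMap
open scoped ComplexConjugate Real ContDiff

/-- The n-th power of a fixed quantity is the form that the composition estimate for iterated
derivatives asks for. Only orders 1 and 2 are non-zero. -/
theorem norm_iteratedFDeriv_normSq_le (n : ℕ) (hn : 1 ≤ n) (z : ℂ) :
    ‖iteratedFDeriv ℝ n (fun z : ℂ => -‖z‖ ^ 2) z‖ ≤ (2 * (1 + ‖z‖)) ^ n := by
  have hneg : iteratedFDeriv ℝ n (fun z : ℂ => -‖z‖ ^ 2) z =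
      -iteratedFDeriv ℝ n (fun z : ℂ => ‖z‖ ^ 2) z := iteratedFDeriv_neg_apply
  rw [hneg, norm_neg]
  obtain _ | _ | n := n
  · omega
  · rw [← norm_iteratedFDeriv_fderiv, norm_iteratedFDeriv_zero, fderiv_norm_sq_apply, two_smul]
    refine (norm_add_le _ _).trans ?_
    rw [innerSL_apply_norm]
    simp
    linarith
  · obtain ⟨L, hL⟩ : ∃ L : ℂ →L[ℝ] ℂ →L[ℝ] ℝ, fderiv ℝ (fun z : ℂ => ‖z‖ ^ 2) = L := by
      refine ⟨innerSL ℝ + innerSL ℝ, ?_⟩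
      ext1 z
      rw [fderiv_norm_sq_apply, two_smul, add_apply]
    have hLn : ‖L‖ ≤ 2 := by
      refine L.opNorm_le_bound (by norm_num) fun z => ?_
      rw [← hL, fderiv_norm_sq_apply, two_smul]
      refine (norm_add_le _ _).trans ?_
      rw [innerSL_apply_norm]
      linarith
    have hfd : fderiv ℝ L = fun _ => L := funext fun z => L.fderiv
    rw [← norm_iteratedFDeriv_fderiv, hL, ← norm_iteratedFDeriv_fderiv, hfd]
    rcases n with _ | n
    · rw [norm_iteratedFDeriv_zero]
      norm_num
      nlinarith [norm_nonneg z]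
    · rw [iteratedFDeriv_succ_const]
      simp only [Pi.zero_apply, norm_zero]
      positivity

theorem norm_iteratedFDeriv_exp_neg_normSq_le (n : ℕ) (z : ℂ) :
    ‖iteratedFDeriv ℝ n (fun z : ℂ => Real.exp (-‖z‖ ^ 2)) z‖ ≤
      n.factorial * Real.exp (-‖z‖ ^ 2) * (2 * (1 + ‖z‖)) ^ n := by
  have hs : ContDiff ℝ n (fun z : ℂ => -‖z‖ ^ 2) := (contDiff_norm_sq ℝ).neg
  refine norm_iteratedFDeriv_comp_le (g := Real.exp) Real.contDiff_exp hs le_rfl z ?_ ?_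
  · intro i _
    rw [norm_iteratedFDeriv_eq_norm_iteratedDeriv, iteratedDeriv_eq_iterate, Real.iter_deriv_exp]
    simp
  · intro i hi _
    exact norm_iteratedFDeriv_normSq_le i hi z

/-- The Gaussian `exp (-|z|²)` as a Schwartz function. -/
noncomputable def gaussR : 𝓢(ℂ, ℝ) where
  toFun z := Real.exp (-‖z‖ ^ 2)
  smooth' := Real.contDiff_exp.comp (contDiff_norm_sq ℝ).neg
  decay' k n := by
    -- The weight is reduced by 1 + |z| ≤ 2 max(1, |z|²), and then t^j exp(-t) ≤ j! is used with t =
    -- |z|² and j = k + n.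
    refine ⟨n.factorial * (2 ^ n * (2 ^ (k + n) * (1 + (k + n).factorial))), fun z => ?_⟩
    have h1 := norm_iteratedFDeriv_exp_neg_normSq_le n z
    have h2 : (1 + ‖z‖) ^ (k + n) * Real.exp (-‖z‖ ^ 2) ≤ 2 ^ (k + n) * (1 + (k + n).factorial) := by
      have h3 : (1 + ‖z‖) ^ 2 ≤ 2 ^ 2 * (max 1 (‖z‖ ^ 2)) := by
        rcases le_total ‖z‖ 1 with h | h
        · nlinarith [le_max_left 1 (‖z‖ ^ 2), norm_nonneg z]
        · nlinarith [le_max_right 1 (‖z‖ ^ 2), norm_nonneg z]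
      have h4 : (1 + ‖z‖) ≤ 2 * (max 1 (‖z‖ ^ 2)) := by
        rcases le_total ‖z‖ 1 with h | h
        · nlinarith [le_max_left 1 (‖z‖ ^ 2), norm_nonneg z]
        · nlinarith [le_max_right 1 (‖z‖ ^ 2), norm_nonneg z]
      have h5 : (max 1 (‖z‖ ^ 2)) ^ (k + n) ≤ 1 + (‖z‖ ^ 2) ^ (k + n) := by
        rcases max_cases 1 (‖z‖ ^ 2) with h | h
        · rw [h.1]
          simp
        · rw [h.1]
          linarith
      have h6 : (‖z‖ ^ 2) ^ (k + n) * Real.exp (-‖z‖ ^ 2) ≤ (k + n).factorial := by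
        have := Real.pow_div_factorial_le_exp (‖z‖ ^ 2) (by positivity) (k + n)
        rw [div_le_iff₀ (by positivity)] at this
        rw [Real.exp_neg, ← div_eq_mul_inv, div_le_iff₀ (by positivity), mul_comm]
        exact this
      have h7 : Real.exp (-‖z‖ ^ 2) ≤ 1 := Real.exp_le_one_iff.2 (by simp)
      calc (1 + ‖z‖) ^ (k + n) * Real.exp (-‖z‖ ^ 2)
          ≤ (2 * max 1 (‖z‖ ^ 2)) ^ (k + n) * Real.exp (-‖z‖ ^ 2) := by gcongr
        _ = 2 ^ (k + n) * ((max 1 (‖z‖ ^ 2)) ^ (k + n) * Real.exp (-‖z‖ ^ 2)) := by ring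
        _ ≤ 2 ^ (k + n) * ((1 + (‖z‖ ^ 2) ^ (k + n)) * Real.exp (-‖z‖ ^ 2)) := by gcongr
        _ ≤ _ := by
          gcongr
          linarith
    calc ‖z‖ ^ k * _ ≤ (1 + ‖z‖) ^ k *
          (n.factorial * Real.exp (-‖z‖ ^ 2) * (2 * (1 + ‖z‖)) ^ n) := by
          refine mul_le_mul (pow_le_pow_left₀ (norm_nonneg z) (by linarith) k) h1
            (norm_nonneg _) (by positivity)
      _ = n.factorial * (2 ^ n * ((1 + ‖z‖) ^ (k + n) * Real.exp (-‖z‖ ^ 2))) := by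
          rw [mul_pow, pow_add]
          ring
      _ ≤ _ := by gcongr

/-- `|z|² exp (-|z|²)` as a Schwartz function. -/
noncomputable def sqGauss : 𝓢(ℂ, ℂ) :=
  smulLeftCLM ℂ (fun z : ℂ => ((‖z‖ ^ 2 : ℝ) : ℂ)) (postcompCLM ofRealCLM gaussR)

theorem sqGauss_apply (z : ℂ) : sqGauss z = (‖z‖ ^ 2 * Real.exp (-‖z‖ ^ 2) : ℝ) := by
  have h : Function.HasTemperateGrowth fun z : ℂ => ((‖z‖ ^ 2 : ℝ) : ℂ) :=
    Function.HasTemperateGrowth.comp Function.Complex.hasTemperateGrowth_ofReal (Function.hasTemperateGrowth_norm_sq ℂ)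
  rw [sqGauss, smulLeftCLM_apply_apply h, postcompCLM_apply, ofRealCLM_apply, smul_eq_mul,
    ← ofReal_mul]
  rfl

/-- The Fourier transform of `|z|² exp (-|z|²)` as a Schwartz function. -/
noncomputable def sqGaussHat : 𝓢(ℂ, ℂ) :=
  compCLMOfContinuousLinearEquiv ℝ (conjCLE) (𝓕 sqGauss)

theorem sqGaussHat_apply (u : ℂ) : sqGaussHat u = fourierC sqGauss u := by
  rw [fourierC_eq]
  rfl

theorem fourierC_sqGaussHat (z : ℂ) : fourierC sqGaussHat z = sqGauss z := by
  have h : (sqGaussHat : ℂ → ℂ) = fourierC sqGauss := funext sqGaussHat_apply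
  rw [h, fourierC_fourierC sqGauss.continuous sqGauss.integrable (h ▸ sqGaussHat.integrable),
    sqGauss_apply, sqGauss_apply, norm_neg]

/-- The transform of the n-th derivative, evaluated n times in the direction conj u, has modulus
(2π)^n |u|^(2n) |F̂(u)|. Its operator norm controls this up to |u|^n, and is at most the L¹ norm of
the derivative. -/
theorem pow_mul_norm_fourierC_le (F : 𝓢(ℂ, ℂ)) (n : ℕ) (u : ℂ) :
    ‖u‖ ^ n * ‖fourierC F u‖ ≤ ∫ z, ‖iteratedFDeriv ℝ n F z‖ := by
  have hint (m : ℕ) : Integrable (iteratedFDeriv ℝ m F) := by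
    refine (integrable_norm_iff ?_).1 (by simpa using F.integrable_pow_mul_iteratedFDeriv volume 0 m)
    exact ((F.smooth m).continuous_iteratedFDeriv le_rfl).aestronglyMeasurable
  have key := congrFun (Real.fourier_iteratedFDeriv (N := ⊤) (f := F) (F.smooth ⊤)
    (fun m _ => hint m) (n := n) le_top) (conj u)
  have hle : ‖𝓕 (iteratedFDeriv ℝ n F) (conj u)‖ ≤ ∫ z, ‖iteratedFDeriv ℝ n F z‖ := by
    rw [Real.fourier_eq]
    refine (norm_integral_le_integral_norm _).trans_eq ?_
    simp
  refine le_trans ?_ hle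
  rcases eq_or_ne u 0 with rfl | hu
  · rcases n with _ | n
    · rw [norm_zero, pow_zero, one_mul, key]
      have := ContinuousMultilinearMap.le_opNorm
        (VectorFourier.fourierPowSMulRight (-innerSL ℝ) (𝓕 (F : ℂ → ℂ)) (conj (0 : ℂ)) 0)
        fun _ => 0
      rw [VectorFourier.fourierPowSMulRight_apply] at this
      simpa [fourierC_eq] using this
    · simp
  have hu' : 0 < ‖u‖ := norm_pos_iff.2 hu
  have h1 := ContinuousMultilinearMap.le_opNorm (𝓕 (iteratedFDeriv ℝ n F) (conj u))
    fun _ => conj u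
  conv_lhs at h1 => rw [key, VectorFourier.fourierPowSMulRight_apply]
  have hi : (-innerSL ℝ) (conj u) (conj u) = -‖u‖ ^ 2 := by
    change -inner ℝ (conj u) (conj u) = _
    rw [real_inner_self_eq_norm_sq, norm_conj]
  simp only [hi, ← fourierC_eq, norm_smul, norm_pow, norm_neg, norm_mul, norm_conj,
    Finset.prod_const, Finset.card_univ, Fintype.card_fin, norm_I, mul_one, norm_real,
    Real.norm_eq_abs, abs_of_pos Real.pi_pos, RCLike.norm_ofNat, abs_norm] at h1
  have hpi : (1 : ℝ) ≤ (2 * π) ^ n := one_le_pow₀ (by linarith [Real.pi_gt_three])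
  have h2 : ‖u‖ ^ n * (‖u‖ ^ n * ‖fourierC F u‖) ≤
      ‖u‖ ^ n * ‖𝓕 (iteratedFDeriv ℝ n F) (conj u)‖ := by
    rw [mul_comm (‖u‖ ^ n) ‖𝓕 (iteratedFDeriv ℝ n F) (conj u)‖]
    refine le_trans ?_ h1
    calc ‖u‖ ^ n * (‖u‖ ^ n * ‖fourierC F u‖)
        = 1 * ((‖u‖ ^ 2) ^ n * ‖fourierC F u‖) := by ring
      _ ≤ _ := by gcongr
  exact le_of_mul_le_mul_left h2 (by positivity)

/-- The function `η(|z|)` on `ℂ`, equal to `0` at the origin. -/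
noncomputable def cutoffC (η : ℝ → ℝ) (z : ℂ) : ℂ := if z = 0 then 0 else (η ‖z‖ : ℂ)

theorem cutoffC_eq_zero {η : ℝ → ℝ} (hη : IsCutoff η) {z : ℂ} (hz : ‖z‖ ≤ 1 / 2) :
    cutoffC η z = 0 := by
  rw [cutoffC]
  split_ifs with h
  · rfl
  · rw [hη.eq_zero _ (norm_pos_iff.2 h) hz, ofReal_zero]

theorem cutoffC_eq_one {η : ℝ → ℝ} (hη : IsCutoff η) {z : ℂ} (hz : 1 ≤ ‖z‖) :
    cutoffC η z = 1 := by
  rw [cutoffC, if_neg (norm_pos_iff.1 (by linarith)), hη.eq_one _ hz, ofReal_one]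

theorem contDiff_cutoffC {η : ℝ → ℝ} (hη : IsCutoff η) : ContDiff ℝ ∞ (cutoffC η) := by
  refine contDiff_iff_contDiffAt.2 fun z => ?_
  rcases lt_or_ge ‖z‖ (1 / 2) with hz | hz
  · refine (contDiffAt_const (c := (0 : ℂ))).congr_of_eventuallyEq ?_
    filter_upwards [(continuous_norm (E := ℂ)).continuousAt.eventually_lt_const hz] with w hw
    exact cutoffC_eq_zero hη hw.le
  · have hz0 : z ≠ 0 := norm_pos_iff.1 (by linarith)
    have h1 : ContDiffAt ℝ ∞ η ‖z‖ :=
      hη.smooth.contDiffAt (Ioi_mem_nhds (norm_pos_iff.2 hz0))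
    have h2 : ContDiffAt ℝ ∞ (fun w : ℂ => (η ‖w‖ : ℂ)) z :=
      ofRealCLM.contDiff.contDiffAt.comp z (h1.comp z (contDiffAt_norm ℝ hz0))
    refine h2.congr_of_eventuallyEq ?_
    filter_upwards [isOpen_ne.mem_nhds hz0] with w hw
    rw [cutoffC, if_neg hw]

/-- The compactly supported function `1 - η(|z|)` as a Schwartz function. -/
noncomputable def bump {η : ℝ → ℝ} (hη : IsCutoff η) : 𝓢(ℂ, ℂ) :=
  HasCompactSupport.toSchwartzMap (f := fun z => 1 - cutoffC η z)
    (HasCompactSupport.of_support_subset_isCompact (isCompact_closedBall 0 1) (by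
      intro z hz
      by_contra h
      rw [mem_closedBall_zero_iff, not_le] at h
      exact hz (by simp [cutoffC_eq_one hη h.le])))
    (contDiff_const.sub (contDiff_cutoffC hη))

theorem bump_apply {η : ℝ → ℝ} (hη : IsCutoff η) (z : ℂ) : bump hη z = 1 - cutoffC η z := rfl

/-- Multiplication by `u ≠ 0` as a real-linear automorphism of `ℂ`. -/
noncomputable def mulEquiv {u : ℂ} (hu : u ≠ 0) : ℂ ≃L[ℝ] ℂ :=
  ContinuousLinearEquiv.smulLeft (Units.mk0 u hu)

/-- The function `z ↦ φ(u z)`. -/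
noncomputable def dilate (φ : 𝓢(ℂ, ℂ)) {u : ℂ} (hu : u ≠ 0) : 𝓢(ℂ, ℂ) :=
  compCLMOfContinuousLinearEquiv ℝ (mulEquiv hu) φ

theorem dilate_apply (φ : 𝓢(ℂ, ℂ)) {u : ℂ} (hu : u ≠ 0) (z : ℂ) : dilate φ hu z = φ (u * z) := rfl

/-- The function `z ↦ η(|z|) φ(u z)`. -/
noncomputable def cutDilate {η : ℝ → ℝ} (hη : IsCutoff η) (φ : 𝓢(ℂ, ℂ)) {u : ℂ} (hu : u ≠ 0) :
    𝓢(ℂ, ℂ) :=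
  dilate φ hu - smulLeftCLM ℂ (bump hη) (dilate φ hu)

theorem cutDilate_apply {η : ℝ → ℝ} (hη : IsCutoff η) (φ : 𝓢(ℂ, ℂ)) {u : ℂ} (hu : u ≠ 0) (z : ℂ) :
    cutDilate hη φ hu z = cutoffC η z * φ (u * z) := by
  rw [cutDilate, sub_apply, smulLeftCLM_apply_apply (bump hη).hasTemperateGrowth, bump_apply,
    dilate_apply, smul_eq_mul]
  ring

theorem norm_iteratedFDeriv_dilate_le (φ : 𝓢(ℂ, ℂ)) {u : ℂ} (hu : u ≠ 0) (i : ℕ) (z : ℂ) :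
    ‖iteratedFDeriv ℝ i (dilate φ hu) z‖ ≤ ‖u‖ ^ i * ‖iteratedFDeriv ℝ i φ (u * z)‖ := by
  have h1 := (mulEquiv hu : ℂ →L[ℝ] ℂ).iteratedFDeriv_comp_right (φ.smooth ⊤) z
    (i := i) (by exact_mod_cast le_top)
  have h2 : ‖(mulEquiv hu : ℂ →L[ℝ] ℂ)‖ ≤ ‖u‖ :=
    ContinuousLinearMap.opNorm_le_bound _ (norm_nonneg u) fun z => (norm_mul u z).le
  have h3 : (dilate φ hu : ℂ → ℂ) = φ ∘ (mulEquiv hu : ℂ →L[ℝ] ℂ) := rfl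
  rw [h3, h1]
  refine (ContinuousMultilinearMap.norm_compContinuousLinearMap_le _ _).trans ?_
  rw [Finset.prod_const, Finset.card_univ, Fintype.card_fin, mul_comm]
  gcongr
  rfl

theorem exists_decay (φ : 𝓢(ℂ, ℂ)) (M i : ℕ) :
    ∃ C, 0 ≤ C ∧ ∀ z, ‖iteratedFDeriv ℝ i φ z‖ ≤ C * ((1 + ‖z‖) ^ M)⁻¹ := by
  refine ⟨2 ^ M * (Finset.Iic (M, i)).sup (fun m => SchwartzMap.seminorm ℝ m.1 m.2) φ,
    by positivity, fun z => ?_⟩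
  have := SchwartzMap.one_add_le_sup_seminorm_apply (𝕜 := ℝ) (m := (M, i)) le_rfl le_rfl φ z
  rw [← div_eq_mul_inv, le_div_iff₀ (by positivity), mul_comm]
  exact this

theorem exists_decay_cutoffC {η : ℝ → ℝ} (hη : IsCutoff η) (i : ℕ) :
    ∃ C, 0 ≤ C ∧ ∀ z, ‖iteratedFDeriv ℝ i (cutoffC η) z‖ ≤
      C * (if i = 0 then 1 else ((1 + ‖z‖) ^ 3)⁻¹) := by
  have hc : cutoffC η = fun z => 1 - bump hη z := by
    ext z
    rw [bump_apply]
    ring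
  rcases eq_or_ne i 0 with rfl | hi
  · obtain ⟨C, hC0, hC⟩ := exists_decay (bump hη) 0 0
    refine ⟨1 + C, by positivity, fun z => ?_⟩
    have := hC z
    rw [norm_iteratedFDeriv_zero] at this ⊢
    rw [hc, if_pos rfl, mul_one]
    refine (norm_sub_le _ _).trans ?_
    rw [norm_one]
    simpa using this
  · obtain ⟨C, hC0, hC⟩ := exists_decay (bump hη) 3 i
    refine ⟨C, hC0, fun z => ?_⟩
    rw [if_neg hi, hc]
    have h1 := iteratedFDeriv_sub_apply (𝕜 := ℝ) (i := i) (x := z) (f := fun _ : ℂ => (1 : ℂ))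
      (g := bump hη) contDiffAt_const ((bump hη).smooth i).contDiffAt
    have h2 : (fun z => 1 - bump hη z) = (fun _ : ℂ => (1 : ℂ)) - bump hη := rfl
    rw [h2, h1, iteratedFDeriv_const_of_ne hi, Pi.zero_apply, zero_sub, norm_neg]
    exact hC z

/-- The point is uniformity as u → 0: both majorants on the right have integrals over z that do not
depend on u. In the Leibniz formula, terms that differentiate η have compact support. The remaining
term carries |u|^k, and k ≥ 2 leaves the factor |u|² which compensates the area scaling of (1 +
|uz|)⁻³. -/
theorem exists_norm_iteratedFDeriv_cutDilate_le {η : ℝ → ℝ} (hη : IsCutoff η) (φ : 𝓢(ℂ, ℂ))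
    {k : ℕ} (hk : 2 ≤ k) (A : ℕ) :
    ∃ C, 0 ≤ C ∧ ∀ (u : ℂ) (hu : u ≠ 0) (z : ℂ), ‖iteratedFDeriv ℝ k (cutDilate hη φ hu) z‖ ≤
      C * ((1 + ‖u‖) ^ A)⁻¹ * (((1 + ‖z‖) ^ 3)⁻¹ + ‖u‖ ^ 2 * ((1 + ‖u * z‖) ^ 3)⁻¹) := by
  choose C hC0 hC using exists_decay_cutoffC hη
  -- The exponent splits in three: A for the decay in u, k to absorb powers of |u|, and 3 for
  -- integrability in z.
  choose D hD0 hD using exists_decay φ (A + k + 3)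
  refine ⟨∑ i ∈ Finset.range (k + 1), k.choose i * (C i * D (k - i) * 2 ^ (A + k)),
    Finset.sum_nonneg fun i _ => by have := hC0 i; have := hD0 (k - i); positivity,
    fun u hu z => ?_⟩
  have hrhs : 0 ≤ ((1 + ‖z‖) ^ 3)⁻¹ + ‖u‖ ^ 2 * ((1 + ‖u * z‖) ^ 3)⁻¹ := by positivity
  have hfun : (cutDilate hη φ hu : ℂ → ℂ) = fun z => cutoffC η z * dilate φ hu z :=
    funext fun z => cutDilate_apply hη φ hu z
  rcases lt_or_ge ‖z‖ (1 / 2) with hz | hz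
  · have h0 : (cutDilate hη φ hu : ℂ → ℂ) =ᶠ[nhds z] fun _ => 0 := by
      filter_upwards [(continuous_norm (E := ℂ)).continuousAt.eventually_lt_const hz] with w hw
      rw [cutDilate_apply, cutoffC_eq_zero hη hw.le, zero_mul]
    rw [(h0.iteratedFDeriv ℝ k).eq_of_nhds]
    have h1 : iteratedFDeriv ℝ k (fun _ : ℂ => (0 : ℂ)) z = 0 := by
      rw [iteratedFDeriv_const_of_ne (by omega)]
      rfl
    rw [h1, norm_zero]
    refine mul_nonneg (mul_nonneg (Finset.sum_nonneg fun i _ => ?_) (by positivity)) hrhs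
    have := hC0 i
    have := hD0 (k - i)
    positivity
  rw [hfun, mul_assoc, Finset.sum_mul]
  refine (norm_iteratedFDeriv_mul_le (N := ∞) (contDiff_cutoffC hη) ((dilate φ hu).smooth ⊤) z
    (by exact_mod_cast le_top)).trans (Finset.sum_le_sum fun i hi => ?_)
  rw [mul_assoc, mul_assoc]
  refine mul_le_mul_of_nonneg_left ?_ (by positivity)
  have hi' : i ≤ k := by simpa [Nat.lt_succ_iff] using hi
  have hDi := hD0 (k - i)
  have hCi := hC0 i
  -- On the support of η one has |z| ≥ 1/2, so decay in u z is also decay in u.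
  have hs : 1 + ‖u‖ ≤ 2 * (1 + ‖u * z‖) := by
    rw [norm_mul]
    nlinarith [norm_nonneg u]
  have hpow : ((1 + ‖u * z‖) ^ (A + k))⁻¹ ≤ 2 ^ (A + k) * ((1 + ‖u‖) ^ (A + k))⁻¹ := by
    rw [← div_eq_mul_inv, le_div_iff₀ (by positivity), ← div_eq_inv_mul,
      div_le_iff₀ (by positivity), ← mul_pow]
    gcongr
  have hone : ((1 + ‖u * z‖) ^ 3)⁻¹ ≤ 1 :=
    inv_le_one_of_one_le₀ (one_le_pow₀ (by linarith [norm_nonneg (u * z)]))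
  have hsA : ∀ j ≤ k, ‖u‖ ^ j * ((1 + ‖u‖) ^ (A + k))⁻¹ ≤ ((1 + ‖u‖) ^ A)⁻¹ := by
    intro j hj
    rw [← div_eq_mul_inv, div_le_iff₀ (by positivity), ← div_eq_inv_mul,
      le_div_iff₀ (by positivity), pow_add, mul_comm]
    gcongr
    calc ‖u‖ ^ j ≤ (1 + ‖u‖) ^ j := by gcongr; linarith
      _ ≤ (1 + ‖u‖) ^ k := pow_le_pow_right₀ (by linarith [norm_nonneg u]) hj
  have hE : (‖u‖ ^ (k - i) * ((1 + ‖u * z‖) ^ (A + k + 3))⁻¹) *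
      (if i = 0 then 1 else ((1 + ‖z‖) ^ 3)⁻¹) ≤
      2 ^ (A + k) * (((1 + ‖u‖) ^ A)⁻¹ *
        (((1 + ‖z‖) ^ 3)⁻¹ + ‖u‖ ^ 2 * ((1 + ‖u * z‖) ^ 3)⁻¹)) := by
    rw [pow_add _ _ 3, mul_inv]
    split_ifs with h0
    · subst h0
      rw [Nat.sub_zero, mul_one]
      have hsplit : ‖u‖ ^ k = ‖u‖ ^ 2 * ‖u‖ ^ (k - 2) := by
        rw [← pow_add]
        congr 1
        omega
      calc ‖u‖ ^ k * (((1 + ‖u * z‖) ^ (A + k))⁻¹ * ((1 + ‖u * z‖) ^ 3)⁻¹)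
          ≤ ‖u‖ ^ k * ((2 ^ (A + k) * ((1 + ‖u‖) ^ (A + k))⁻¹) * ((1 + ‖u * z‖) ^ 3)⁻¹) := by
            gcongr
        _ = 2 ^ (A + k) * ((‖u‖ ^ (k - 2) * ((1 + ‖u‖) ^ (A + k))⁻¹) *
              (‖u‖ ^ 2 * ((1 + ‖u * z‖) ^ 3)⁻¹)) := by
            rw [hsplit]
            ring
        _ ≤ _ := by
            gcongr
            · exact hsA _ (by omega)
            · exact le_add_of_nonneg_left (by positivity)
    · calc ‖u‖ ^ (k - i) * (((1 + ‖u * z‖) ^ (A + k))⁻¹ * ((1 + ‖u * z‖) ^ 3)⁻¹) *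
            ((1 + ‖z‖) ^ 3)⁻¹
          ≤ ‖u‖ ^ (k - i) * ((2 ^ (A + k) * ((1 + ‖u‖) ^ (A + k))⁻¹) * 1) *
            ((1 + ‖z‖) ^ 3)⁻¹ := by gcongr
        _ = 2 ^ (A + k) * ((‖u‖ ^ (k - i) * ((1 + ‖u‖) ^ (A + k))⁻¹) * ((1 + ‖z‖) ^ 3)⁻¹) := by
            ring
        _ ≤ _ := by
            gcongr
            · exact hsA _ (by omega)
            · exact le_add_of_nonneg_right (by positivity)
  calc ‖iteratedFDeriv ℝ i (cutoffC η) z‖ * ‖iteratedFDeriv ℝ (k - i) (dilate φ hu) z‖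
      ≤ (C i * (if i = 0 then 1 else ((1 + ‖z‖) ^ 3)⁻¹)) *
        (‖u‖ ^ (k - i) * (D (k - i) * ((1 + ‖u * z‖) ^ (A + k + 3))⁻¹)) := by
        refine mul_le_mul (hC i z) ((norm_iteratedFDeriv_dilate_le φ hu _ z).trans ?_)
          (norm_nonneg _) (mul_nonneg hCi (by split_ifs <;> positivity))
        exact mul_le_mul_of_nonneg_left (hD _ _) (by positivity)
    _ = (C i * D (k - i)) * ((‖u‖ ^ (k - i) * ((1 + ‖u * z‖) ^ (A + k + 3))⁻¹) *
        (if i = 0 then 1 else ((1 + ‖z‖) ^ 3)⁻¹)) := by ring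
    _ ≤ (C i * D (k - i)) * (2 ^ (A + k) * (((1 + ‖u‖) ^ A)⁻¹ *
        (((1 + ‖z‖) ^ 3)⁻¹ + ‖u‖ ^ 2 * ((1 + ‖u * z‖) ^ 3)⁻¹))) := by gcongr
    _ = _ := by ring

theorem integrable_inv_one_add_norm_pow {n : ℕ} (hn : 3 ≤ n) :
    Integrable fun z : ℂ => ((1 + ‖z‖) ^ n)⁻¹ := by
  have h := integrable_one_add_norm (E := ℂ) (μ := volume) (r := n) (by
    rw [Complex.finrank_real_complex]
    exact_mod_cast hn)
  refine h.congr (.of_forall fun z => ?_)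
  simp only
  rw [Real.rpow_neg (by positivity), Real.rpow_natCast]

/-- Uniform decay of the Fourier transform of `η(|z|) φ(u z)`. -/
theorem exists_norm_fourierC_cutDilate_le {η : ℝ → ℝ} (hη : IsCutoff η) (φ : 𝓢(ℂ, ℂ))
    {k : ℕ} (hk : 2 ≤ k) (A : ℕ) :
    ∃ C, 0 ≤ C ∧ ∀ (u : ℂ) (hu : u ≠ 0) (v : ℂ),
      ‖v‖ ^ k * ‖fourierC (cutDilate hη φ hu) v‖ ≤ C * ((1 + ‖u‖) ^ A)⁻¹ := by
  obtain ⟨C, hC0, hC⟩ := exists_norm_iteratedFDeriv_cutDilate_le hη φ hk A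
  have hI := integrable_inv_one_add_norm_pow le_rfl
  refine ⟨C * (2 * ∫ z : ℂ, ((1 + ‖z‖) ^ 3)⁻¹), mul_nonneg hC0 (mul_nonneg zero_le_two
    (integral_nonneg fun z => by positivity)), fun u hu v => ?_⟩
  refine (pow_mul_norm_fourierC_le _ k v).trans ?_
  have hI2 : Integrable fun z : ℂ => ‖u‖ ^ 2 * ((1 + ‖u * z‖) ^ 3)⁻¹ :=
    (integrable_comp_mul_left hI hu).const_mul _
  have hu' : ‖u‖ ≠ 0 := norm_ne_zero_iff.2 hu
  calc ∫ z, ‖iteratedFDeriv ℝ k (cutDilate hη φ hu) z‖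
      ≤ ∫ z : ℂ, C * ((1 + ‖u‖) ^ A)⁻¹ *
          (((1 + ‖z‖) ^ 3)⁻¹ + ‖u‖ ^ 2 * ((1 + ‖u * z‖) ^ 3)⁻¹) :=
        integral_mono_of_nonneg (.of_forall fun z => norm_nonneg _)
          ((hI.add hI2).const_mul _) (.of_forall fun z => hC u hu z)
    _ = _ := by
        rw [integral_const_mul, integral_add hI hI2, integral_const_mul,
          integral_comp_mul_left (fun z : ℂ => ((1 + ‖z‖) ^ 3)⁻¹) hu, smul_eq_mul]
        field_simp
        ring

/-! ### The weight f and its Fourier transform -/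

theorem fIntegrand_eq (η : ℝ → ℝ) (T : ℝ) (w v z : ℂ) :
    fIntegrand η T w v z =
      cutoffC η z * ((h T (w / z) / ‖z‖ ^ 4 : ℝ) : ℂ) * e (-(v * z)) := by
  rw [fIntegrand, cutoffC]
  split_ifs with hz
  · simp [hz]
  · push_cast
    ring

theorem h_nonneg (T : ℝ) (z : ℂ) : 0 ≤ h T z := (Real.exp_pos _).le

theorem h_le_one (T : ℝ) (z : ℂ) : h T z ≤ 1 := Real.exp_le_one_iff.2 (by
  rw [Left.neg_nonpos_iff]
  positivity)

theorem measurable_cutoffC {η : ℝ → ℝ} (hη : IsCutoff η) : Measurable (cutoffC η) :=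
  (contDiff_cutoffC hη).continuous.measurable

theorem measurable_h (T : ℝ) : Measurable (h T) := by
  unfold h
  fun_prop

theorem measurable_fIntegrand {η : ℝ → ℝ} (hη : IsCutoff η) (T : ℝ) (w v : ℂ) :
    Measurable (fIntegrand η T w v) := by
  have h0 := measurable_cutoffC hη
  have h1 : Measurable fun z : ℂ => h T (w / z) := (measurable_h T).comp (by fun_prop)
  have h2 : Measurable fun z : ℂ => e (-(v * z)) := continuous_e.measurable.comp (by fun_prop)
  rw [funext (fIntegrand_eq η T w v)]
  fun_prop

theorem exists_norm_fIntegrand_le {η : ℝ → ℝ} (hη : IsCutoff η) :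
    ∃ C, ∀ (T : ℝ) (w v z : ℂ), ‖fIntegrand η T w v z‖ ≤ C * ((1 + ‖z‖) ^ 4)⁻¹ := by
  obtain ⟨C, hC0, hC⟩ := exists_decay_cutoffC hη 0
  refine ⟨C * 81, fun T w v z => ?_⟩
  have h1 := hC z
  rw [norm_iteratedFDeriv_zero, if_pos rfl, mul_one] at h1
  rw [fIntegrand_eq, norm_mul, norm_e, mul_one, norm_mul, norm_real, Real.norm_eq_abs,
    abs_of_nonneg (div_nonneg (h_nonneg _ _) (by positivity))]
  rcases lt_or_ge ‖z‖ (1 / 2) with hz | hz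
  · rw [cutoffC_eq_zero hη hz.le, norm_zero, zero_mul]
    positivity
  · have h2 : h T (w / z) / ‖z‖ ^ 4 ≤ 81 * ((1 + ‖z‖) ^ 4)⁻¹ := by
      rw [← div_eq_mul_inv, div_le_div_iff₀ (by positivity) (by positivity)]
      calc h T (w / z) * (1 + ‖z‖) ^ 4 ≤ 1 * (3 * ‖z‖) ^ 4 := by
            gcongr
            · exact h_le_one _ _
            · linarith
        _ = _ := by ring
    rw [mul_assoc]
    exact mul_le_mul h1 h2 (div_nonneg (h_nonneg _ _) (by positivity)) hC0

theorem integrable_fIntegrand {η : ℝ → ℝ} (hη : IsCutoff η) (T : ℝ) (w v : ℂ) :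
    Integrable (fIntegrand η T w v) := by
  obtain ⟨C, hC⟩ := exists_norm_fIntegrand_le hη
  exact ((integrable_inv_one_add_norm_pow (n := 4) (by norm_num)).const_mul C).mono'
    (measurable_fIntegrand hη T w v).aestronglyMeasurable (.of_forall fun z => hC T w v z)

theorem continuous_f {η : ℝ → ℝ} (hη : IsCutoff η) (T : ℝ) (v : ℂ) :
    Continuous fun w => f η T w v := by
  obtain ⟨C, hC⟩ := exists_norm_fIntegrand_le hη
  have h1 : Continuous fun w : ℂ => ∫ z, fIntegrand η T w v z := by
    refine continuous_of_dominated (bound := fun z => C * ((1 + ‖z‖) ^ 4)⁻¹)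
      (fun w => (measurable_fIntegrand hη T w v).aestronglyMeasurable)
      (fun w => .of_forall fun z => hC T w v z)
      ((integrable_inv_one_add_norm_pow (n := 4) (by norm_num)).const_mul C)
      (.of_forall fun z => ?_)
    unfold fIntegrand h
    fun_prop
  unfold f
  fun_prop

/-- T enters only through w/T, so the analysis of f and f̂ reduces to T = 1. -/
theorem f_eq_smul {T : ℝ} (hT : 0 < T) (η : ℝ → ℝ) (w v : ℂ) :
    f η T w v = (T ^ 2 : ℝ) * f η 1 (w / T) v := by
  have h1 : ∀ z, fIntegrand η T w v z = fIntegrand η 1 (w / T) v z := by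
    intro z
    have : h T (w / z) = h 1 (w / T / z) := by
      simp only [h, norm_div, norm_real, Real.norm_eq_abs, abs_of_pos hT]
      congr 2
      field_simp
    rw [fIntegrand, fIntegrand, this]
  rw [f, f, integral_congr_ae (.of_forall h1), ← mul_assoc, ← ofReal_mul, norm_div, norm_real,
    Real.norm_eq_abs, abs_of_pos hT]
  congr 2
  field_simp

theorem fHat_eq_smul {T : ℝ} (hT : 0 < T) (η : ℝ → ℝ) (u v : ℂ) :
    fHat η T u v = (T ^ 4 : ℝ) * fHat η 1 (T * u) v := by
  have hTc : (T : ℂ) ≠ 0 := ofReal_ne_zero.2 hT.ne'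
  have hT' : ((T : ℂ))⁻¹ ≠ 0 := inv_ne_zero hTc
  have h1 := integral_comp_mul_left (fun w => f η 1 w v * e (-(T * u * w))) hT'
  have h2 : fHat η T u v =
      ∫ w : ℂ, ((T ^ 2 : ℝ) : ℂ) *
        (f η 1 ((T : ℂ)⁻¹ * w) v * e (-(T * u * ((T : ℂ)⁻¹ * w)))) := by
    refine integral_congr_ae (.of_forall fun w => ?_)
    simp only
    rw [f_eq_smul hT, ← mul_assoc, div_eq_inv_mul]
    congr 3
    field_simp
  rw [h2, integral_const_mul, h1, fHat, real_smul, ← mul_assoc, ← ofReal_mul, norm_inv, norm_real,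
    Real.norm_eq_abs, abs_of_pos hT]
  congr 2
  field_simp

/-- The same kernel |w|² |z|⁻⁴ exp(-|w/z|²) is read as a dilated function of w (left) or of z
(right). The first reading serves Fubini, the second the closed form without cut-off. -/
theorem sqGauss_div {w z : ℂ} (hw : w ≠ 0) (hz : z ≠ 0) :
    ((‖z‖ ^ 2)⁻¹ : ℝ) * sqGauss (w / z) = ((‖w‖ ^ 2)⁻¹ : ℝ) * invGauss (w⁻¹ * z) := by
  have hw' : ‖w‖ ≠ 0 := norm_ne_zero_iff.2 hw
  have hz' : ‖z‖ ≠ 0 := norm_ne_zero_iff.2 hz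
  rw [sqGauss_apply, invGauss, ← ofReal_mul, ← ofReal_mul]
  congr 1
  have h1 : ‖w / z‖ ^ 2 = (‖w⁻¹ * z‖ ^ 2)⁻¹ := by
    rw [← inv_pow, ← norm_inv]
    congr 2
    field_simp
  rw [h1]
  simp only [norm_mul, norm_inv]
  field_simp

/-- The part of `f(w; v)` coming from small `z`. -/
noncomputable def fSmall {η : ℝ → ℝ} (hη : IsCutoff η) (w v : ℂ) : ℂ :=
  ∫ z, bump hη z * (((‖z‖ ^ 2)⁻¹ : ℝ) * sqGauss (w / z)) * e (-(v * z))

/-- With η replaced by 1, the substitution z ↦ w z turns the integral into the transform of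
`invGauss` at v w. The excess is supported on |z| ≤ 1. -/
theorem f_eq_sub {η : ℝ → ℝ} (hη : IsCutoff η) {w : ℂ} (hw : w ≠ 0) (v : ℂ) :
    f η 1 w v = fourierC invGauss (v * w) - fSmall hη w v := by
  have hw' : ‖w‖ ≠ 0 := norm_ne_zero_iff.2 hw
  have hwi : w⁻¹ ≠ 0 := inv_ne_zero hw
  have hI : Integrable fun z => ((‖w‖ ^ 2)⁻¹ : ℝ) * invGauss (w⁻¹ * z) :=
    (integrable_comp_mul_left integrable_invGauss hwi).const_mul _
  have hB : Integrable fun z => bump hη z * (((‖w‖ ^ 2)⁻¹ : ℝ) * invGauss (w⁻¹ * z)) := by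
    obtain ⟨C, hC⟩ := exists_decay (bump hη) 0 0
    refine hI.bdd_mul (c := C) (bump hη).continuous.aestronglyMeasurable (.of_forall fun z => ?_)
    simpa using hC.2 z
  have h1 : fourierC invGauss (v * w) =
      ∫ z, (((‖w‖ ^ 2)⁻¹ : ℝ) * invGauss (w⁻¹ * z)) * e (-(v * z)) := by
    have := fourierC_comp_mul invGauss hwi v
    rw [div_inv_eq_mul] at this
    simp_rw [mul_assoc]
    rw [integral_const_mul, ← fourierC, this, ← mul_assoc, ← ofReal_mul, norm_inv, inv_pow, inv_inv,
      inv_mul_cancel₀ (by positivity), ofReal_one, one_mul]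
  have h2 : fSmall hη w v =
      ∫ z, bump hη z * (((‖w‖ ^ 2)⁻¹ : ℝ) * invGauss (w⁻¹ * z)) * e (-(v * z)) := by
    refine integral_congr_ae (.of_forall fun z => ?_)
    simp only
    rcases eq_or_ne z 0 with rfl | hz
    · simp [invGauss]
    · rw [sqGauss_div hw hz]
  rw [h1, h2, ← integral_sub (integrable_mul_e hI (by fun_prop)) (integrable_mul_e hB (by fun_prop)),
    f, ← integral_const_mul]
  refine integral_congr_ae (.of_forall fun z => ?_)
  simp only
  rw [fIntegrand_eq, bump_apply]
  rcases eq_or_ne z 0 with rfl | hz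
  · simp [invGauss]
  have hz' : ‖z‖ ≠ 0 := norm_ne_zero_iff.2 hz
  rw [← sqGauss_div hw hz, sqGauss_apply]
  have h3 : ‖w‖ ^ 2 * (h 1 (w / z) / ‖z‖ ^ 4) =
      (‖z‖ ^ 2)⁻¹ * (‖w / z‖ ^ 2 * Real.exp (-‖w / z‖ ^ 2)) := by
    rw [h, norm_div]
    field_simp
  have h4 := congrArg (fun x : ℝ => (x : ℂ)) h3
  simp only [ofReal_mul] at h4 ⊢
  linear_combination (cutoffC η z * e (-(v * z))) * h4

theorem fourierC_sqGauss_div {z : ℂ} (hz : z ≠ 0) (u : ℂ) :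
    ∫ w, (((‖z‖ ^ 2)⁻¹ : ℝ) * sqGauss (w / z)) * e (-(u * w)) = sqGaussHat (u * z) := by
  have hz' : ‖z‖ ≠ 0 := norm_ne_zero_iff.2 hz
  have := fourierC_comp_mul sqGauss (inv_ne_zero hz) u
  rw [div_inv_eq_mul] at this
  simp_rw [mul_assoc, div_eq_inv_mul]
  rw [integral_const_mul, ← fourierC, this, ← mul_assoc, ← ofReal_mul, norm_inv, inv_pow, inv_inv,
      inv_mul_cancel₀ (by positivity), ofReal_one, one_mul, sqGaussHat_apply]

/-- The factor |z|⁻² cancels the Jacobian of w ↦ w/z. Hence the w-integral of the modulus is |1 -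
η(|z|)| times a constant, integrable in z by compact support. -/
theorem integrable_fSmall_prod {η : ℝ → ℝ} (hη : IsCutoff η) (v : ℂ) :
    Integrable (fun p : ℂ × ℂ =>
      bump hη p.2 * (((‖p.2‖ ^ 2)⁻¹ : ℝ) * sqGauss (p.1 / p.2)) * e (-(v * p.2)))
      (volume.prod volume) := by
  have hm : Measurable fun p : ℂ × ℂ =>
      bump hη p.2 * (((‖p.2‖ ^ 2)⁻¹ : ℝ) * sqGauss (p.1 / p.2)) * e (-(v * p.2)) := by
    have h1 : Measurable fun p : ℂ × ℂ => sqGauss (p.1 / p.2) :=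
      sqGauss.continuous.measurable.comp (by fun_prop)
    have h2 : Measurable fun p : ℂ × ℂ => bump hη p.2 :=
      (bump hη).continuous.measurable.comp (by fun_prop)
    have h3 : Measurable fun p : ℂ × ℂ => e (-(v * p.2)) :=
      continuous_e.measurable.comp (by fun_prop)
    fun_prop
  have hne : ∀ᵐ z : ℂ, z ≠ 0 := by simp [ae_iff]
  refine (integrable_prod_iff' hm.aestronglyMeasurable).2 ⟨?_, ?_⟩
  · filter_upwards [hne] with z hz
    have := (integrable_comp_mul_left sqGauss.integrable (inv_ne_zero hz) (F := sqGauss))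
    simp_rw [div_eq_inv_mul]
    exact ((this.const_mul _).const_mul _).mul_const _
  · refine ((bump hη).integrable.norm.mul_const (∫ w, ‖sqGauss w‖)).congr ?_
    filter_upwards [hne] with z hz
    have hz' : ‖z‖ ≠ 0 := norm_ne_zero_iff.2 hz
    have := integral_comp_mul_left (fun w => ‖sqGauss w‖) (inv_ne_zero hz)
    simp only [norm_mul, norm_e, mul_one, norm_real]
    simp_rw [div_eq_inv_mul]
    rw [integral_const_mul, integral_const_mul, this, smul_eq_mul, norm_inv, norm_inv z, inv_pow,
      inv_inv, Real.norm_of_nonneg (by positivity), inv_mul_cancel_left₀ (by positivity)]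

theorem integrable_fSmall {η : ℝ → ℝ} (hη : IsCutoff η) (v : ℂ) :
    Integrable fun w => fSmall hη w v :=
  (integrable_fSmall_prod hη v).integral_prod_left

theorem fourierC_fSmall {η : ℝ → ℝ} (hη : IsCutoff η) (u v : ℂ) :
    fourierC (fun w => fSmall hη w v) u = ∫ z, bump hη z * sqGaussHat (u * z) * e (-(v * z)) := by
  have h1 : ∀ w, fSmall hη w v * e (-(u * w)) = ∫ z, bump hη z *
      (((‖z‖ ^ 2)⁻¹ : ℝ) * sqGauss (w / z)) * e (-(v * z)) * e (-(u * w)) :=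
    fun w => (integral_mul_const _ _).symm
  have hint : Integrable (Function.uncurry fun w z => bump hη z *
      (((‖z‖ ^ 2)⁻¹ : ℝ) * sqGauss (w / z)) * e (-(v * z)) * e (-(u * w)))
      (volume.prod volume) := by
    refine (integrable_fSmall_prod hη v).mul_bdd (c := 1) ?_ (.of_forall fun p => (norm_e _).le)
    exact (continuous_e.comp (by fun_prop)).aestronglyMeasurable
  rw [fourierC, integral_congr_ae (.of_forall h1), integral_integral_swap hint]
  have hne : ∀ᵐ z : ℂ, z ≠ 0 := by simp [ae_iff]
  refine integral_congr_ae ?_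
  filter_upwards [hne] with z hz
  rw [← fourierC_sqGauss_div hz u, mul_right_comm, ← integral_const_mul]
  refine integral_congr_ae (.of_forall fun w => ?_)
  simp only
  ring

theorem integrable_f_one {η : ℝ → ℝ} (hη : IsCutoff η) {v : ℂ} (hv : v ≠ 0) :
    Integrable fun w => f η 1 w v := by
  have hne : ∀ᵐ w : ℂ, w ≠ 0 := by simp [ae_iff]
  refine ((integrable_comp_mul_left integrable_fourierC_invGauss hv).sub
    (integrable_fSmall hη v)).congr ?_
  filter_upwards [hne] with w hw
  exact (f_eq_sub hη hw v).symm

theorem integrable_f {η : ℝ → ℝ} (hη : IsCutoff η) {T : ℝ} (hT : 0 < T) {v : ℂ} (hv : v ≠ 0) :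
    Integrable fun w => f η T w v := by
  have hT' : ((T : ℂ))⁻¹ ≠ 0 := inv_ne_zero (ofReal_ne_zero.2 hT.ne')
  refine ((integrable_comp_mul_left (integrable_f_one hη hv) hT').const_mul
    ((T ^ 2 : ℝ) : ℂ)).congr (.of_forall fun w => ?_)
  simp only
  rw [f_eq_smul hT, div_eq_inv_mul]

theorem fHat_eq_fourierC (η : ℝ → ℝ) (T : ℝ) (u v : ℂ) :
    fHat η T u v = fourierC (fun w => f η T w v) u := rfl

/-- Formally an interchange of integrals, which is legitimate only for the compactly supported part.
The main part is transformed by Fourier inversion instead. -/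
theorem fHat_one_eq {η : ℝ → ℝ} (hη : IsCutoff η) {u v : ℂ} (hu : u ≠ 0) (hv : v ≠ 0) :
    fHat η 1 u v = fourierC (cutDilate hη sqGaussHat hu) v := by
  have hne : ∀ᵐ w : ℂ, w ≠ 0 := by simp [ae_iff]
  have hv' : ‖v‖ ≠ 0 := norm_ne_zero_iff.2 hv
  have hF := integrable_comp_mul_left integrable_fourierC_invGauss hv
  have h1 : fHat η 1 u v = fourierC (fun w => fourierC invGauss (v * w)) u -
      fourierC (fun w => fSmall hη w v) u := by
    rw [fHat_eq_fourierC, fourierC, fourierC, fourierC, ← integral_sub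
      (integrable_mul_e hF (by fun_prop)) (integrable_mul_e (integrable_fSmall hη v) (by fun_prop))]
    refine integral_congr_ae ?_
    filter_upwards [hne] with w hw
    rw [f_eq_sub hη hw v, sub_mul]
  have h2 : fourierC (dilate sqGaussHat hu) v = ((‖u‖ ^ 2)⁻¹ : ℝ) * sqGauss (v / u) := by
    rw [← fourierC_sqGaussHat]
    exact fourierC_comp_mul sqGaussHat hu v
  have h3 : fourierC (cutDilate hη sqGaussHat hu) v = fourierC (dilate sqGaussHat hu) v -
      ∫ z, bump hη z * sqGaussHat (u * z) * e (-(v * z)) := by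
    rw [fourierC, fourierC, ← integral_sub
      (integrable_mul_e (dilate sqGaussHat hu).integrable (by fun_prop))]
    · refine integral_congr_ae (.of_forall fun z => ?_)
      simp only
      rw [cutDilate_apply, bump_apply, dilate_apply]
      ring
    · refine integrable_mul_e ?_ (by fun_prop)
      refine ((dilate sqGaussHat hu).integrable.sub
        (cutDilate hη sqGaussHat hu).integrable).congr (.of_forall fun z => ?_)
      simp only [Pi.sub_apply]
      rw [cutDilate_apply, bump_apply, dilate_apply]
      ring
  -- The compact parts cancel, and the main terms |v|⁻² G(u/v) and |u|⁻² g(v/u) agree by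
  -- `sqGauss_div`.
  rw [h1, h3, h2, fourierC_fSmall, fourierC_comp_mul _ hv, fourierC_fourierC_invGauss,
    sqGauss_div hv hu, div_eq_inv_mul]

/-- The central estimate: k counts integrations by parts in z, A comes from the rapid decay of ĝ,
and T⁴ and T|u| from rescaling. At u = 0 the formula behind it degenerates; this null set is ignored
in later integrals. -/
theorem exists_norm_fHat_le {η : ℝ → ℝ} (hη : IsCutoff η) {k : ℕ} (hk : 2 ≤ k) (A : ℕ) :
    ∃ C, 0 ≤ C ∧ ∀ T : ℝ, 1 ≤ T → ∀ u v : ℂ, u ≠ 0 → v ≠ 0 →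
      ‖fHat η T u v‖ ≤ C * T ^ 4 * (‖v‖ ^ k)⁻¹ * ((1 + T * ‖u‖) ^ A)⁻¹ := by
  obtain ⟨C, hC0, hC⟩ := exists_norm_fourierC_cutDilate_le hη sqGaussHat hk A
  refine ⟨C, hC0, fun T hT u v hu hv => ?_⟩
  have hT0 : 0 < T := by linarith
  have hv' : 0 < ‖v‖ := norm_pos_iff.2 hv
  have hTu : (T : ℂ) * u ≠ 0 := mul_ne_zero (ofReal_ne_zero.2 hT0.ne') hu
  have h1 := hC _ hTu v
  rw [← fHat_one_eq hη hTu hv, norm_mul, norm_real, Real.norm_of_nonneg hT0.le, mul_comm,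
    ← le_div_iff₀ (by positivity)] at h1
  rw [fHat_eq_smul hT0, norm_mul, norm_real, Real.norm_of_nonneg (by positivity)]
  calc T ^ 4 * ‖fHat η 1 (T * u) v‖
      ≤ T ^ 4 * (C * ((1 + T * ‖u‖) ^ A)⁻¹ / ‖v‖ ^ k) := by gcongr
    _ = _ := by ring

theorem continuous_fHat {η : ℝ → ℝ} (hη : IsCutoff η) {T : ℝ} (hT : 0 < T) {v : ℂ} (hv : v ≠ 0) :
    Continuous fun u => fHat η T u v :=
  continuous_fourierC (integrable_f hη hT hv)

/-- The exponent 4 makes the later sums over q = v c converge; the exponent 3 in u gives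
integrability on the plane. -/
theorem exists_integral_norm_fHat_le {η : ℝ → ℝ} (hη : IsCutoff η) :
    ∃ C, 0 ≤ C ∧ ∀ T : ℝ, 1 ≤ T → ∀ v : ℂ, v ≠ 0 → Integrable (fun u => fHat η T u v) ∧
      ∫ u, ‖fHat η T u v‖ ≤ C * T ^ 4 * (‖v‖ ^ 4)⁻¹ := by
  obtain ⟨C, hC0, hC⟩ := exists_norm_fHat_le hη (k := 4) (by norm_num) 3
  have hI := integrable_inv_one_add_norm_pow le_rfl
  refine ⟨C * ∫ z : ℂ, ((1 + ‖z‖) ^ 3)⁻¹,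
    mul_nonneg hC0 (integral_nonneg fun z => by positivity), fun T hT v hv => ?_⟩
  have hb : ∀ᵐ u : ℂ, ‖fHat η T u v‖ ≤ C * T ^ 4 * (‖v‖ ^ 4)⁻¹ * ((1 + ‖u‖) ^ 3)⁻¹ := by
    have hne : ∀ᵐ u : ℂ, u ≠ 0 := by simp [ae_iff]
    filter_upwards [hne] with u hu
    refine (hC T hT u v hu hv).trans ?_
    gcongr
    nlinarith [norm_nonneg u]
  refine ⟨(hI.const_mul _).mono'
    (continuous_fHat hη (by linarith) hv).aestronglyMeasurable hb, ?_⟩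
  refine (integral_mono_of_nonneg (.of_forall fun u => norm_nonneg _)
    (hI.const_mul _) hb).trans_eq ?_
  rw [integral_const_mul]
  ring

theorem f_eq_integral_fHat {η : ℝ → ℝ} (hη : IsCutoff η) {T : ℝ} (hT : 1 ≤ T) {v : ℂ} (hv : v ≠ 0)
    (w : ℂ) : f η T w v = ∫ u, fHat η T u v * e (u * w) := by
  obtain ⟨C, -, hC⟩ := exists_integral_norm_fHat_le hη
  have := fourierC_fourierC (continuous_f hη T v) (integrable_f hη (by linarith) hv)
    (hC T hT v hv).1 (-w)
  rw [neg_neg] at this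
  rw [← this]
  refine integral_congr_ae (.of_forall fun u => ?_)
  simp only [neg_mul, neg_neg, mul_comm w u]
  rfl

end DualSum

/-! ### Kloosterman sums and the dual sum on the Fourier side -/

namespace DualSum

open MeasureTheory Complex
open scoped ComplexConjugate Real

/-- The Gaussian integers in a closed disc. -/
noncomputable def disc (R : ℝ) : Finset GaussianInt := (finite_norm_le R).toFinset

theorem mem_disc {R : ℝ} {n : GaussianInt} : n ∈ disc R ↔ ‖GaussianInt.toComplex n‖ ≤ R := by
  simp [disc]

theorem mem_puncturedDisc {R : ℝ} {n : GaussianInt} :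
    n ∈ puncturedDisc R ↔ ‖GaussianInt.toComplex n‖ ≤ R ∧ n ≠ 0 := by
  simp [puncturedDisc]

theorem mem_annulus {N : ℝ} {n : GaussianInt} :
    n ∈ annulus N ↔ ‖GaussianInt.toComplex n‖ ≤ 2 * N ∧ N < ‖GaussianInt.toComplex n‖ := by
  simp [annulus]

theorem puncturedDisc_subset_disc (R : ℝ) : puncturedDisc R ⊆ disc R := fun _ hn =>
  mem_disc.2 (mem_puncturedDisc.1 hn).1

theorem annulus_subset_disc (N : ℝ) : annulus N ⊆ disc (2 * N) := fun _ hn =>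
  mem_disc.2 (mem_annulus.1 hn).1

theorem card_disc_le {R : ℝ} (hR : 0 ≤ R) : ((disc R).card : ℝ) ≤ (2 * R + 1) ^ 2 := by
  have hinj : Set.InjOn (fun n : GaussianInt => (n.re, n.im)) (disc R : Set GaussianInt) := by
    intro x _ y _ hxy
    simp only [Prod.mk.injEq] at hxy
    exact Zsqrtd.ext hxy.1 hxy.2
  have hmap : ∀ n ∈ disc R, (n.re, n.im) ∈
      Finset.Icc (-⌊R⌋) ⌊R⌋ ×ˢ Finset.Icc (-⌊R⌋) ⌊R⌋ := by
    intro n hn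
    rw [mem_disc] at hn
    have key : ∀ k : ℤ, |(k : ℝ)| ≤ R → k ∈ Finset.Icc (-⌊R⌋) ⌊R⌋ := by
      intro k hk
      have h1 : |k| ≤ ⌊R⌋ := Int.le_floor.2 (by exact_mod_cast hk)
      exact Finset.mem_Icc.2 (abs_le.1 h1)
    have h1 : |(n.re : ℝ)| ≤ R := by
      rw [GaussianInt.intCast_re]
      exact (Complex.abs_re_le_norm _).trans hn
    have h2 : |(n.im : ℝ)| ≤ R := by
      rw [GaussianInt.intCast_im]
      exact (Complex.abs_im_le_norm _).trans hn
    exact Finset.mem_product.2 ⟨key _ h1, key _ h2⟩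
  have hcard := Finset.card_le_card_of_injOn _ hmap hinj
  rw [Finset.card_product, Int.card_Icc] at hcard
  have hfl : 0 ≤ ⌊R⌋ := Int.floor_nonneg.2 hR
  have h3 : (((⌊R⌋ + 1 - -⌊R⌋).toNat : ℕ) : ℝ) ≤ 2 * R + 1 := by
    have h4 : (((⌊R⌋ + 1 - -⌊R⌋).toNat : ℤ) : ℝ) = 2 * ⌊R⌋ + 1 := by
      rw [Int.toNat_of_nonneg (by omega)]
      push_cast
      ring
    rw [← Int.cast_natCast, h4]
    linarith [Int.floor_le R]
  calc ((disc R).card : ℝ) ≤ ((⌊R⌋ + 1 - -⌊R⌋).toNat * (⌊R⌋ + 1 - -⌊R⌋).toNat : ℕ) := by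
        exact_mod_cast hcard
    _ = (((⌊R⌋ + 1 - -⌊R⌋).toNat : ℕ) : ℝ) ^ 2 := by
        push_cast
        ring
    _ ≤ _ := by gcongr

theorem one_le_norm_toComplex {c : GaussianInt} (hc : c ≠ 0) : 1 ≤ ‖GaussianInt.toComplex c‖ := by
  have h1 : (1 : ℝ) ≤ c.norm := by exact_mod_cast GaussianInt.norm_pos.2 hc
  rw [GaussianInt.intCast_real_norm, Complex.normSq_eq_norm_sq] at h1
  nlinarith [norm_nonneg (GaussianInt.toComplex c)]

theorem toComplex_ne_zero {c : GaussianInt} (hc : c ≠ 0) : GaussianInt.toComplex c ≠ 0 :=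
  mt GaussianInt.toComplex_eq_zero.1 hc

theorem norm_toComplex_mod_le (x : GaussianInt) {c : GaussianInt} (hc : c ≠ 0) :
    ‖GaussianInt.toComplex (x % c)‖ ≤ ‖GaussianInt.toComplex c‖ := by
  have h1 : ((x % c).norm : ℝ) ≤ c.norm := by exact_mod_cast (GaussianInt.norm_mod_lt x hc).le
  rw [GaussianInt.intCast_real_norm, GaussianInt.intCast_real_norm, Complex.normSq_eq_norm_sq,
    Complex.normSq_eq_norm_sq] at h1
  exact (sq_le_sq₀ (norm_nonneg _) (norm_nonneg _)).1 h1

/-- The residue ring modulo `c`. -/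
abbrev Residue (c : GaussianInt) : Type := GaussianInt ⧸ Ideal.span {c}

theorem mk_out {c : GaussianInt} (α : Residue c) :
    Ideal.Quotient.mk (Ideal.span {c}) (Quotient.out α) = α := Quotient.out_eq α

theorem injective_out_mod (c : GaussianInt) :
    Function.Injective fun α : Residue c => Quotient.out α % c := by
  intro α β hαβ
  have key : ∀ γ : Residue c, Ideal.Quotient.mk (Ideal.span {c}) (Quotient.out γ % c) = γ := by
    intro γ
    conv_rhs => rw [← mk_out γ]
    rw [Ideal.Quotient.eq, Ideal.mem_span_singleton]
    exact ⟨-(Quotient.out γ / c), by rw [GaussianInt.mod_def]; ring⟩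
  rw [← key α, ← key β]
  exact congrArg _ hαβ

theorem finite_residue {c : GaussianInt} (hc : c ≠ 0) : Finite (Residue c) := by
  refine Finite.of_injective (β := disc ‖GaussianInt.toComplex c‖)
    (fun α => ⟨Quotient.out α % c, mem_disc.2 (norm_toComplex_mod_le _ hc)⟩) ?_
  intro α β hαβ
  exact injective_out_mod c (congrArg Subtype.val hαβ)

/-- Euclidean remainders modulo c lie in the disc of radius |c| and determine the class. -/
theorem card_residue_le {c : GaussianInt} (hc : c ≠ 0) :
    (Nat.card (Residue c) : ℝ) ≤ 9 * ‖GaussianInt.toComplex c‖ ^ 2 := by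
  have := finite_residue hc
  have h1 : Nat.card (Residue c) ≤ (disc ‖GaussianInt.toComplex c‖).card := by
    rw [← Nat.card_eq_finsetCard]
    refine Nat.card_le_card_of_injective
      (fun α => ⟨Quotient.out α % c, mem_disc.2 (norm_toComplex_mod_le _ hc)⟩) ?_
    intro α β hαβ
    exact injective_out_mod c (congrArg Subtype.val hαβ)
  have h2 := card_disc_le (norm_nonneg (GaussianInt.toComplex c))
  have h3 := one_le_norm_toComplex hc
  calc (Nat.card (Residue c) : ℝ) ≤ (2 * ‖GaussianInt.toComplex c‖ + 1) ^ 2 :=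
        (by exact_mod_cast h1 : (Nat.card (Residue c) : ℝ) ≤ _).trans h2
    _ ≤ (3 * ‖GaussianInt.toComplex c‖) ^ 2 := by
        gcongr
        linarith
    _ = _ := by ring

theorem card_units_le {c : GaussianInt} (hc : c ≠ 0) :
    (Nat.card (Residue c)ˣ : ℝ) ≤ 9 * ‖GaussianInt.toComplex c‖ ^ 2 := by
  have := finite_residue hc
  refine le_trans ?_ (card_residue_le hc)
  exact_mod_cast Nat.card_le_card_of_injective _ (Units.val_injective (α := Residue c))

theorem e_div_eq_of_sub_mem {c x y : GaussianInt} (hc : c ≠ 0) (hxy : x - y ∈ Ideal.span {c}) :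
    e (GaussianInt.toComplex x / GaussianInt.toComplex c) =
      e (GaussianInt.toComplex y / GaussianInt.toComplex c) := by
  obtain ⟨t, ht⟩ := Ideal.mem_span_singleton.1 hxy
  have h1 : GaussianInt.toComplex x / GaussianInt.toComplex c =
      GaussianInt.toComplex y / GaussianInt.toComplex c + GaussianInt.toComplex t := by
    have hc' := toComplex_ne_zero hc
    rw [sub_eq_iff_eq_add.1 ht, GaussianInt.toComplex_add, GaussianInt.toComplex_mul]
    field_simp
    ring
  rw [h1, e_add, e_gaussianInt, mul_one]

theorem kloosterman_eq_sum (m n : GaussianInt) {c : GaussianInt} [Fintype (Residue c)ˣ] :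
    kloosterman m n c = ∑ α : (Residue c)ˣ,
      e (GaussianInt.toComplex (Quotient.out (α : Residue c) * m +
        Quotient.out ((α⁻¹ : (Residue c)ˣ) : Residue c) * n) / GaussianInt.toComplex c) :=
  finsum_eq_sum_of_fintype _

theorem norm_kloosterman_le (m n : GaussianInt) {c : GaussianInt} (hc : c ≠ 0) :
    ‖kloosterman m n c‖ ≤ 9 * ‖GaussianInt.toComplex c‖ ^ 2 := by
  have := finite_residue hc
  have := Fintype.ofFinite (Residue c)ˣ
  rw [kloosterman_eq_sum]
  refine (norm_sum_le _ _).trans (le_trans ?_ (card_units_le hc))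
  simp [norm_e]

/-- The substitution α ↦ -α conjugates every term, so the sum is real. -/
theorem conj_kloosterman (m n : GaussianInt) {c : GaussianInt} (hc : c ≠ 0) :
    conj (kloosterman m n c) = kloosterman m n c := by
  have := finite_residue hc
  have := Fintype.ofFinite (Residue c)ˣ
  rw [kloosterman_eq_sum, map_sum]
  refine Fintype.sum_equiv (Equiv.neg _) _ _ fun α => ?_
  rw [← e_neg, ← neg_div, ← GaussianInt.toComplex_neg]
  refine e_div_eq_of_sub_mem hc ?_
  rw [← Ideal.Quotient.eq]
  simp only [map_neg, map_add, map_mul, mk_out, Equiv.neg_apply, Units.val_neg, inv_neg]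
  ring

theorem normSq_nonneg (a : Ideal GaussianInt → ℝ) (N : ℝ) : 0 ≤ normSq a N :=
  Finset.sum_nonneg fun _ _ => by positivity

/-- Reality of the coefficients and of the Kloosterman sums is what makes the product over m and n a
squared modulus. -/
theorem sq_norm_expSum_eq (N : ℝ) (a : Ideal GaussianInt → ℝ) {c : GaussianInt} (hc : c ≠ 0)
    (q : GaussianInt) (u : ℂ) :
    ((‖expSum N a c q u‖ ^ 2 : ℝ) : ℂ) = ∑ m ∈ annulus N, ∑ n ∈ annulus N,
      (a (Ideal.span {m}) : ℂ) * (a (Ideal.span {n}) : ℂ) *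
        (kloosterman m q c * kloosterman n q c *
          e (GaussianInt.toComplex (m - n) / GaussianInt.toComplex c * u)) := by
  rw [← Complex.normSq_eq_norm_sq, Complex.normSq_eq_conj_mul_self, mul_comm, expSum, map_sum,
    Finset.sum_mul_sum]
  refine Finset.sum_congr rfl fun m _ => Finset.sum_congr rfl fun n _ => ?_
  have h1 : GaussianInt.toComplex (m - n) / GaussianInt.toComplex c * u =
      GaussianInt.toComplex m / GaussianInt.toComplex c * u +
        -(GaussianInt.toComplex n / GaussianInt.toComplex c * u) := by
    rw [GaussianInt.toComplex_sub]
    ring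
  rw [h1, e_add, e_neg, map_mul, map_mul, conj_kloosterman _ _ hc, conj_ofReal]
  ring

/-- A trivial bound, used only in tails: 2025 = 81 · 25, with 81 from squaring |S(n, q; c)| ≤ 9|c|²
and 25N² bounding the number of n in Cauchy-Schwarz. -/
theorem sq_norm_expSum_le {N : ℝ} (hN : 1 ≤ N) (a : Ideal GaussianInt → ℝ) {c : GaussianInt}
    (hc : c ≠ 0) (q : GaussianInt) (u : ℂ) :
    ‖expSum N a c q u‖ ^ 2 ≤ 2025 * N ^ 2 * ‖GaussianInt.toComplex c‖ ^ 4 * normSq a N := by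
  have h1 : ‖expSum N a c q u‖ ≤
      9 * ‖GaussianInt.toComplex c‖ ^ 2 * ∑ n ∈ annulus N, |a (Ideal.span {n})| := by
    refine (norm_sum_le _ _).trans ?_
    rw [Finset.mul_sum]
    refine Finset.sum_le_sum fun n _ => ?_
    rw [norm_mul, norm_mul, norm_e, mul_one, norm_real, Real.norm_eq_abs, mul_comm]
    exact mul_le_mul_of_nonneg_right (norm_kloosterman_le n q hc) (abs_nonneg _)
  have h2 : (∑ n ∈ annulus N, |a (Ideal.span {n})|) ^ 2 ≤ 25 * N ^ 2 * normSq a N := by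
    refine sq_sum_le_card_mul_sum_sq.trans ?_
    refine mul_le_mul_of_nonneg_right ?_ (normSq_nonneg a N)
    calc ((annulus N).card : ℝ) ≤ (disc (2 * N)).card := by
          exact_mod_cast Finset.card_le_card (annulus_subset_disc N)
      _ ≤ (2 * (2 * N) + 1) ^ 2 := card_disc_le (by linarith)
      _ ≤ (5 * N) ^ 2 := by
          gcongr
          linarith
      _ = _ := by ring
  calc ‖expSum N a c q u‖ ^ 2
      ≤ (9 * ‖GaussianInt.toComplex c‖ ^ 2 * ∑ n ∈ annulus N, |a (Ideal.span {n})|) ^ 2 := by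
        gcongr
    _ = 81 * ‖GaussianInt.toComplex c‖ ^ 4 * (∑ n ∈ annulus N, |a (Ideal.span {n})|) ^ 2 := by ring
    _ ≤ 81 * ‖GaussianInt.toComplex c‖ ^ 4 * (25 * N ^ 2 * normSq a N) := by gcongr
    _ = _ := by ring

theorem summable_norm_rpow_neg {r : ℝ} (hr : 2 < r) :
    Summable fun q : {q : GaussianInt // q ≠ 0} => ‖GaussianInt.toComplex q‖ ^ (-r) := by
  have h1 := EisensteinSeries.summable_one_div_norm_rpow hr
  have hinj : Function.Injective fun q : {q : GaussianInt // q ≠ 0} => ![q.1.re, q.1.im] := by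
    intro x y hxy
    have h2 := congrFun hxy 0
    have h3 := congrFun hxy 1
    simp at h2 h3
    exact Subtype.ext (Zsqrtd.ext h2 h3)
  refine (h1.comp_injective hinj).of_nonneg_of_le (fun q => by positivity) fun q => ?_
  have hne : (![q.1.re, q.1.im] : Fin 2 → ℤ) ≠ 0 := by
    intro h0
    have h2 := congrFun h0 0
    have h3 := congrFun h0 1
    simp at h2 h3
    exact q.2 (Zsqrtd.ext h2 h3)
  refine Real.rpow_le_rpow_of_nonpos (norm_pos_iff.2 hne) ?_ (by linarith)
  refine (pi_norm_le_iff_of_nonneg (norm_nonneg _)).2 fun i => ?_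
  fin_cases i
  · simpa [GaussianInt.intCast_re, Int.norm_eq_abs] using
      Complex.abs_re_le_norm (GaussianInt.toComplex q)
  · simpa [GaussianInt.intCast_im, Int.norm_eq_abs] using
      Complex.abs_im_le_norm (GaussianInt.toComplex q)

theorem summable_inv_norm_pow_four :
    Summable fun q : {q : GaussianInt // q ≠ 0} => (‖GaussianInt.toComplex q‖ ^ 4)⁻¹ := by
  refine (summable_norm_rpow_neg (r := 4) (by norm_num)).congr fun q => ?_
  rw [Real.rpow_neg (norm_nonneg _)]
  norm_cast

theorem norm_f_le {η : ℝ → ℝ} (hη : IsCutoff η) :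
    ∃ C, 0 ≤ C ∧ ∀ T : ℝ, 1 ≤ T → ∀ w v : ℂ, v ≠ 0 →
      ‖f η T w v‖ ≤ C * T ^ 4 * (‖v‖ ^ 4)⁻¹ := by
  obtain ⟨C, hC0, hC⟩ := exists_integral_norm_fHat_le hη
  refine ⟨C, hC0, fun T hT w v hv => le_trans ?_ (hC T hT v hv).2⟩
  rw [f_eq_integral_fHat hη hT hv]
  refine (norm_integral_le_integral_norm _).trans_eq ?_
  simp [norm_e]

theorem div_toComplex_ne_zero {c q : GaussianInt} (hc : c ≠ 0) (hq : q ≠ 0) :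
    GaussianInt.toComplex q / GaussianInt.toComplex c ≠ 0 :=
  div_ne_zero (toComplex_ne_zero hq) (toComplex_ne_zero hc)

theorem summable_dualTerm {η : ℝ → ℝ} (hη : IsCutoff η) {T : ℝ} (hT : 1 ≤ T) (m n : GaussianInt)
    {c : GaussianInt} (hc : c ≠ 0) :
    Summable fun q : {q : GaussianInt // q ≠ 0} => dualTerm η T m n c q := by
  obtain ⟨C, hC0, hC⟩ := norm_f_le hη
  set K : ℝ := 9 * ‖GaussianInt.toComplex c‖ ^ 2 with hK
  refine Summable.of_norm_bounded (g := fun q : {q : GaussianInt // q ≠ 0} =>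
    K * K * (C * T ^ 4 * ‖GaussianInt.toComplex c‖ ^ 4) * (‖GaussianInt.toComplex q‖ ^ 4)⁻¹)
    (summable_inv_norm_pow_four.mul_left _) fun q => ?_
  rw [dualTerm, norm_mul, norm_mul, mul_assoc (K * K)]
  have h1 := hC T hT ((π : ℂ) * GaussianInt.toComplex (m - n) / GaussianInt.toComplex c) _
    (div_toComplex_ne_zero hc q.2)
  have h2 : C * T ^ 4 * (‖GaussianInt.toComplex q / GaussianInt.toComplex c‖ ^ 4)⁻¹ =
      C * T ^ 4 * ‖GaussianInt.toComplex c‖ ^ 4 * (‖GaussianInt.toComplex q‖ ^ 4)⁻¹ := by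
    rw [norm_div, div_pow, inv_div]
    ring
  rw [h2] at h1
  have h3 := norm_kloosterman_le m q hc
  have h4 := norm_kloosterman_le n q hc
  gcongr

theorem pi_ne_zero' : (π : ℂ) ≠ 0 := ofReal_ne_zero.2 Real.pi_ne_zero

theorem integral_comp_div_pi {E : Type*} [NormedAddCommGroup E] [NormedSpace ℝ E] (F : ℂ → E) :
    ∫ u : ℂ, F (u / π) = π ^ 2 • ∫ u, F u := by
  have := integral_comp_mul_left F (inv_ne_zero pi_ne_zero')
  simp_rw [div_eq_inv_mul]
  rw [this, norm_inv, inv_pow, inv_inv, norm_real, Real.norm_of_nonneg Real.pi_pos.le]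

theorem integrable_fHat_div_pi {η : ℝ → ℝ} (hη : IsCutoff η) {T : ℝ} (hT : 1 ≤ T) {v : ℂ}
    (hv : v ≠ 0) : Integrable fun u : ℂ => fHat η T (u / π) v := by
  obtain ⟨C, -, hC⟩ := exists_integral_norm_fHat_le hη
  simp_rw [div_eq_inv_mul]
  exact integrable_comp_mul_left (hC T hT v hv).1 (inv_ne_zero pi_ne_zero')

/-- The rescaling u ↦ u/π uses up both the prefactor π² of the dual sum and the π in the argument of
f. -/
theorem pi_sq_mul_f {η : ℝ → ℝ} (hη : IsCutoff η) {T : ℝ} (hT : 1 ≤ T) {v : ℂ} (hv : v ≠ 0)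
    (x : ℂ) : (π : ℂ) ^ 2 * f η T (π * x) v = ∫ u : ℂ, fHat η T (u / π) v * e (x * u) := by
  have h1 := integral_comp_div_pi fun u => fHat η T u v * e (u * (π * x))
  rw [← f_eq_integral_fHat hη hT hv, real_smul] at h1
  push_cast at h1
  rw [← h1]
  refine integral_congr_ae (.of_forall fun u => ?_)
  have h2 : u / π * (π * x) = x * u := by
    have := pi_ne_zero'
    field_simp
  simp only [h2]

@[fun_prop]
theorem continuous_expSum (N : ℝ) (a : Ideal GaussianInt → ℝ) (c q : GaussianInt) :
    Continuous (expSum N a c q) := by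
  unfold expSum
  fun_prop

/-- The integrand of `S₀`. -/
noncomputable def fourierTerm (η : ℝ → ℝ) (T N : ℝ) (a : Ideal GaussianInt → ℝ)
    (c q : GaussianInt) (u : ℂ) : ℂ :=
  fHat η T (u / (π : ℂ)) (GaussianInt.toComplex q / GaussianInt.toComplex c) *
    ((‖expSum N a c q u‖ ^ 2 : ℝ) : ℂ)

theorem integrable_fourierTerm {η : ℝ → ℝ} (hη : IsCutoff η) {T : ℝ} (hT : 1 ≤ T) {N : ℝ}
    (hN : 1 ≤ N) (a : Ideal GaussianInt → ℝ) {c q : GaussianInt} (hc : c ≠ 0) (hq : q ≠ 0) :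
    Integrable (fourierTerm η T N a c q) := by
  refine (integrable_fHat_div_pi hη hT (div_toComplex_ne_zero hc hq)).mul_bdd
    (c := 2025 * N ^ 2 * ‖GaussianInt.toComplex c‖ ^ 4 * normSq a N)
    (by fun_prop) (.of_forall fun u => ?_)
  rw [norm_real, Real.norm_of_nonneg (by positivity)]
  exact sq_norm_expSum_le hN a hc q u

theorem norm_fourierTerm_le (η : ℝ → ℝ) (T : ℝ) {N : ℝ}
    (hN : 1 ≤ N) (a : Ideal GaussianInt → ℝ) {c : GaussianInt} (hc : c ≠ 0) (q : GaussianInt)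
    (u : ℂ) : ‖fourierTerm η T N a c q u‖ ≤
      2025 * N ^ 2 * ‖GaussianInt.toComplex c‖ ^ 4 * normSq a N *
        ‖fHat η T (u / (π : ℂ)) (GaussianInt.toComplex q / GaussianInt.toComplex c)‖ := by
  rw [fourierTerm, norm_mul, norm_real, Real.norm_of_nonneg (by positivity), mul_comm]
  exact mul_le_mul_of_nonneg_right (sq_norm_expSum_le hN a hc q u) (norm_nonneg _)

theorem sum_dualTerm_eq {η : ℝ → ℝ} (hη : IsCutoff η) {T : ℝ} (hT : 1 ≤ T) (N : ℝ)
    (a : Ideal GaussianInt → ℝ) {c q : GaussianInt} (hc : c ≠ 0) (hq : q ≠ 0) :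
    (π : ℂ) ^ 2 * ∑ m ∈ annulus N, ∑ n ∈ annulus N,
        (a (Ideal.span {m}) : ℂ) * (a (Ideal.span {n}) : ℂ) * dualTerm η T m n c q =
      ∫ u, fourierTerm η T N a c q u := by
  have hv := div_toComplex_ne_zero hc hq
  have hint : ∀ x : ℂ, Integrable fun u : ℂ =>
      fHat η T (u / π) (GaussianInt.toComplex q / GaussianInt.toComplex c) * e (x * u) :=
    fun x => integrable_mul_e (integrable_fHat_div_pi hη hT hv) (by fun_prop)
  have h1 : ∀ u, fourierTerm η T N a c q u = ∑ m ∈ annulus N, ∑ n ∈ annulus N,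
      (a (Ideal.span {m}) : ℂ) * (a (Ideal.span {n}) : ℂ) *
        (kloosterman m q c * kloosterman n q c) *
        (fHat η T (u / π) (GaussianInt.toComplex q / GaussianInt.toComplex c) *
          e (GaussianInt.toComplex (m - n) / GaussianInt.toComplex c * u)) := by
    intro u
    rw [fourierTerm, sq_norm_expSum_eq N a hc q u, Finset.mul_sum]
    refine Finset.sum_congr rfl fun m _ => ?_
    rw [Finset.mul_sum]
    refine Finset.sum_congr rfl fun n _ => ?_
    ring
  rw [integral_congr_ae (.of_forall h1), integral_finsetSum _ fun m _ =>
    integrable_finsetSum _ fun n _ => (hint _).const_mul _, Finset.mul_sum]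
  refine Finset.sum_congr rfl fun m _ => ?_
  rw [integral_finsetSum _ fun n _ => (hint _).const_mul _, Finset.mul_sum]
  refine Finset.sum_congr rfl fun n _ => ?_
  rw [integral_const_mul, ← pi_sq_mul_f hη hT hv, dualTerm, mul_div_assoc]
  ring

/-- The finite sums over m and n are moved inside the absolutely convergent sum over q, where they
combine into the square. -/
theorem S_eq_tsum {η : ℝ → ℝ} (hη : IsCutoff η) {T : ℝ} (hT : 1 ≤ T) (N X : ℝ)
    (a : Ideal GaussianInt → ℝ) :
    S η T N X a = ∑ c ∈ puncturedDisc X, ((1 / ‖GaussianInt.toComplex c‖ ^ 4 : ℝ) : ℂ) *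
      ∑' q : {q : GaussianInt // q ≠ 0}, ∫ u, fourierTerm η T N a c q u := by
  rw [S, Finset.mul_sum]
  refine Finset.sum_congr rfl fun c hc => ?_
  have hc0 := (mem_puncturedDisc.1 hc).2
  rw [mul_left_comm]
  congr 1
  have h1 : ∀ m n : GaussianInt, Summable fun q : {q : GaussianInt // q ≠ 0} =>
      (a (Ideal.span {m}) : ℂ) * (a (Ideal.span {n}) : ℂ) * dualTerm η T m n c q :=
    fun m n => (summable_dualTerm hη hT m n hc0).mul_left _
  rw [tsum_congr fun q : {q : GaussianInt // q ≠ 0} =>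
      (sum_dualTerm_eq hη hT N a hc0 q.2).symm, tsum_mul_left,
    Summable.tsum_finsetSum fun m _ => summable_sum fun n _ => h1 m n]
  congr 1
  refine Finset.sum_congr rfl fun m _ => ?_
  rw [Summable.tsum_finsetSum fun n _ => h1 m n]
  refine Finset.sum_congr rfl fun n _ => ?_
  rw [tsum_mul_left]

/-! ### Truncation of the dual sum -/

/-- Decay of `f̂` outside the truncated ranges. -/
theorem exists_tail_fHat_le {η : ℝ → ℝ} (hη : IsCutoff η) {ε : ℝ} (hε : 0 < ε) :
    ∃ C, 0 ≤ C ∧ ∀ T N : ℝ, 1 ≤ T → 1 ≤ N → ∀ v : ℂ, v ≠ 0 →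
      (N ^ ε < ‖v‖ → ∫ u : ℂ, ‖fHat η T (u / π) v‖ ≤ C * T ^ 4 * (N ^ 12)⁻¹ * (‖v‖ ^ 4)⁻¹) ∧
      ∫ u in (Metric.closedBall (0 : ℂ) (N ^ ε / T))ᶜ, ‖fHat η T (u / π) v‖ ≤
        C * T ^ 4 * (N ^ 12)⁻¹ * (‖v‖ ^ 4)⁻¹ := by
  -- With εj ≥ 12, each excess factor N^(εj) saves N¹².
  obtain ⟨j, hj⟩ := exists_nat_ge (12 / ε)
  have hj' : 12 ≤ ε * j := by
    rw [div_le_iff₀ hε] at hj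
    linarith
  have hNj : ∀ N : ℝ, 1 ≤ N → N ^ 12 ≤ (N ^ ε) ^ j := by
    intro N hN
    rw [← Real.rpow_natCast (N ^ ε), ← Real.rpow_mul (by linarith), ← Real.rpow_natCast N 12]
    exact Real.rpow_le_rpow_of_exponent_le hN (by exact_mod_cast hj')
  -- For large v: j extra powers of |v| give the saving, 4 remain for the sum over q.
  obtain ⟨C, hC0, hC⟩ := exists_norm_fHat_le hη (k := 4 + j) (by omega) 3
  -- For large u: j powers of 1 + T|u/π| give the saving, 3 remain for the integral. The division by
  -- π costs π^j.
  obtain ⟨D, hD0, hD⟩ := exists_norm_fHat_le hη (k := 4) (by omega) (j + 3)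
  have hI := integrable_inv_one_add_norm_pow le_rfl
  have hIpi : Integrable fun u : ℂ => ((1 + ‖u / π‖) ^ 3)⁻¹ := by
    simp_rw [div_eq_inv_mul]
    exact integrable_comp_mul_left hI (inv_ne_zero pi_ne_zero')
  set I₃ : ℝ := ∫ u : ℂ, ((1 + ‖u / π‖) ^ 3)⁻¹ with hI₃
  have hI₃0 : 0 ≤ I₃ := integral_nonneg fun u => by positivity
  have hne : ∀ᵐ u : ℂ, u ≠ 0 := by simp [ae_iff]
  refine ⟨C * I₃ + D * π ^ j * I₃, by positivity, fun T N hT hN v hv => ⟨fun hNv => ?_, ?_⟩⟩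
  · have hN0 : 0 < N := by linarith
    have hv' : 0 < ‖v‖ := norm_pos_iff.2 hv
    have hb : ∀ᵐ u : ℂ, ‖fHat η T (u / π) v‖ ≤
        C * T ^ 4 * ((N ^ 12)⁻¹ * (‖v‖ ^ 4)⁻¹) * ((1 + ‖u / π‖) ^ 3)⁻¹ := by
      filter_upwards [hne] with u hu
      refine (hC T hT (u / π) v (div_ne_zero hu pi_ne_zero') hv).trans ?_
      have h1 : (‖v‖ ^ (4 + j))⁻¹ ≤ (N ^ 12)⁻¹ * (‖v‖ ^ 4)⁻¹ := by
        rw [← mul_inv]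
        refine inv_anti₀ (by positivity) ?_
        rw [pow_add, mul_comm]
        gcongr
        refine (hNj N hN).trans ?_
        gcongr
      gcongr
      nlinarith [norm_nonneg (u / π)]
    refine (integral_mono_of_nonneg (.of_forall fun u => norm_nonneg _)
      (hIpi.const_mul _) hb).trans ?_
    rw [integral_const_mul]
    calc C * T ^ 4 * ((N ^ 12)⁻¹ * (‖v‖ ^ 4)⁻¹) * I₃
        = (C * I₃) * T ^ 4 * (N ^ 12)⁻¹ * (‖v‖ ^ 4)⁻¹ := by ring
      _ ≤ _ := by
        gcongr
        exact le_add_of_nonneg_right (by positivity)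
  · have hN0 : 0 < N := by linarith
    have hT0 : 0 < T := by linarith
    have hb : ∀ᵐ u : ℂ ∂(volume.restrict (Metric.closedBall (0 : ℂ) (N ^ ε / T))ᶜ),
        ‖fHat η T (u / π) v‖ ≤
        D * T ^ 4 * (‖v‖ ^ 4)⁻¹ * (π ^ j * (N ^ 12)⁻¹) * ((1 + ‖u / π‖) ^ 3)⁻¹ := by
      filter_upwards [ae_restrict_mem Metric.isClosed_closedBall.measurableSet.compl,
        ae_restrict_of_ae hne] with u hu hu0
      refine (hD T hT (u / π) v (div_ne_zero hu0 pi_ne_zero') hv).trans ?_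
      rw [Set.mem_compl_iff, mem_closedBall_zero_iff, not_le, div_lt_iff₀ hT0] at hu
      have hnorm : ‖u / π‖ = ‖u‖ / π := by
        rw [norm_div, norm_real, Real.norm_of_nonneg Real.pi_pos.le]
      have h1 : N ^ ε / π ≤ 1 + T * ‖u / π‖ := by
        rw [hnorm, ← mul_div_assoc]
        have : N ^ ε / π ≤ T * ‖u‖ / π := by
          gcongr
          linarith
        linarith
      have h2 : ((1 + T * ‖u / π‖) ^ (j + 3))⁻¹ ≤
          π ^ j * (N ^ 12)⁻¹ * ((1 + ‖u / π‖) ^ 3)⁻¹ := by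
        rw [pow_add, mul_inv]
        have h3 : ((1 + T * ‖u / π‖) ^ j)⁻¹ ≤ π ^ j * (N ^ 12)⁻¹ := by
          rw [← div_eq_mul_inv, ← inv_div (N ^ 12)]
          refine inv_anti₀ (by positivity) ?_
          calc N ^ 12 / π ^ j ≤ (N ^ ε) ^ j / π ^ j := by
                gcongr
                exact hNj N hN
            _ = (N ^ ε / π) ^ j := (div_pow _ _ _).symm
            _ ≤ _ := by gcongr
        gcongr
        nlinarith [norm_nonneg (u / π)]
      calc D * T ^ 4 * (‖v‖ ^ 4)⁻¹ * ((1 + T * ‖u / π‖) ^ (j + 3))⁻¹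
          ≤ D * T ^ 4 * (‖v‖ ^ 4)⁻¹ * (π ^ j * (N ^ 12)⁻¹ * ((1 + ‖u / π‖) ^ 3)⁻¹) := by gcongr
        _ = _ := by ring
    refine (integral_mono_of_nonneg (.of_forall fun u => norm_nonneg _)
      (hIpi.const_mul _).integrableOn hb).trans ?_
    rw [integral_const_mul]
    have h4 : ∫ u : ℂ in (Metric.closedBall (0 : ℂ) (N ^ ε / T))ᶜ, ((1 + ‖u / π‖) ^ 3)⁻¹ ≤ I₃ :=
      setIntegral_le_integral hIpi (.of_forall fun u => by positivity)
    calc D * T ^ 4 * (‖v‖ ^ 4)⁻¹ * (π ^ j * (N ^ 12)⁻¹) *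
          ∫ u : ℂ in (Metric.closedBall (0 : ℂ) (N ^ ε / T))ᶜ, ((1 + ‖u / π‖) ^ 3)⁻¹
        ≤ D * T ^ 4 * (‖v‖ ^ 4)⁻¹ * (π ^ j * (N ^ 12)⁻¹) * I₃ := by gcongr
      _ = (D * π ^ j * I₃) * T ^ 4 * (N ^ 12)⁻¹ * (‖v‖ ^ 4)⁻¹ := by ring
      _ ≤ _ := by
        gcongr
        exact le_add_of_nonneg_left (by positivity)

theorem norm_S_sub_S₀_le {η : ℝ → ℝ} (hη : IsCutoff η) {ε : ℝ} (hε : 0 < ε) :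
    ∃ C, 0 ≤ C ∧ ∀ X T N : ℝ, 1 ≤ X → X ≤ T → T < N → ∀ a : Ideal GaussianInt → ℝ,
      ‖S η T N X a - S₀ η ε T N X a‖ ≤ C * normSq a N := by
  obtain ⟨C, hC0, hC⟩ := exists_tail_fHat_le hη hε
  set Q : ℝ := ∑' q : {q : GaussianInt // q ≠ 0}, (‖GaussianInt.toComplex q‖ ^ 4)⁻¹ with hQ
  have hQ0 : 0 ≤ Q := tsum_nonneg fun q => by positivity
  refine ⟨9 * 2025 * C * Q, by positivity, fun X T N hX hXT hTN a => ?_⟩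
  have hT : 1 ≤ T := hX.trans hXT
  have hN : 1 ≤ N := hT.trans hTN.le
  have hA := normSq_nonneg a N
  have hterm : ∀ c ∈ puncturedDisc X,
      ‖((1 / ‖GaussianInt.toComplex c‖ ^ 4 : ℝ) : ℂ) *
        (∑' q : {q : GaussianInt // q ≠ 0}, ∫ u, fourierTerm η T N a c q u) -
      ((1 / ‖GaussianInt.toComplex c‖ ^ 4 : ℝ) : ℂ) *
        ∑ q ∈ puncturedDisc (‖GaussianInt.toComplex c‖ * N ^ ε),
          ∫ u in Metric.closedBall (0 : ℂ) (N ^ ε / T), fourierTerm η T N a c q u‖ ≤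
      2025 * N ^ 2 * normSq a N * (C * T ^ 4 * (N ^ 12)⁻¹) * ‖GaussianInt.toComplex c‖ ^ 4 * Q := by
    intro c hc
    have hc0 := (mem_puncturedDisc.1 hc).2
    have hc1 := one_le_norm_toComplex hc0
    set R := ‖GaussianInt.toComplex c‖ * N ^ ε with hR
    have hcpos : 0 < ‖GaussianInt.toComplex c‖ := by linarith
    set M := 2025 * N ^ 2 * ‖GaussianInt.toComplex c‖ ^ 4 * normSq a N with hM
    have hM0 : 0 ≤ M := by positivity
    set s : Finset {q : GaussianInt // q ≠ 0} := (puncturedDisc R).subtype (· ≠ 0) with hs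
    set I : {q : GaussianInt // q ≠ 0} → ℂ := fun q => ∫ u, fourierTerm η T N a c q u with hI
    set J : GaussianInt → ℂ := fun q =>
      ∫ u in Metric.closedBall (0 : ℂ) (N ^ ε / T), fourierTerm η T N a c q u with hJ
    -- The truncated sum is extended by zero to all q ≠ 0, so that a single termwise bound covers
    -- both tails.
    have hJsum : ∑ q ∈ puncturedDisc R, J q = ∑' q : {q : GaussianInt // q ≠ 0},
        if q ∈ s then J q else 0 := by
      rw [tsum_eq_sum (s := s) fun q hq => if_neg hq, Finset.sum_congr rfl fun q hq => if_pos hq,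
        hs, Finset.sum_subtype_of_mem J fun q hq => (mem_puncturedDisc.1 hq).2]
    have hbound : ∀ q : {q : GaussianInt // q ≠ 0}, ‖I q - if q ∈ s then J q else 0‖ ≤
        M * (C * T ^ 4 * (N ^ 12)⁻¹) * ‖GaussianInt.toComplex c‖ ^ 4 *
          (‖GaussianInt.toComplex q‖ ^ 4)⁻¹ := by
      intro q
      have hv := div_toComplex_ne_zero hc0 q.2
      have hint := integrable_fourierTerm hη hT hN a hc0 q.2
      have hfi := (integrable_fHat_div_pi hη hT hv).norm
      obtain ⟨h1, h2⟩ := hC T N hT hN _ hv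
      have h3 : C * T ^ 4 * (N ^ 12)⁻¹ *
          (‖GaussianInt.toComplex q / GaussianInt.toComplex c‖ ^ 4)⁻¹ =
          C * T ^ 4 * (N ^ 12)⁻¹ * ‖GaussianInt.toComplex c‖ ^ 4 *
            (‖GaussianInt.toComplex q‖ ^ 4)⁻¹ := by
        rw [norm_div, div_pow, inv_div]
        ring
      rw [h3] at h1 h2
      have h4 := norm_fourierTerm_le η T hN a hc0 q
      split_ifs with hq
      · have h5 : I q - J q =
            ∫ u in (Metric.closedBall (0 : ℂ) (N ^ ε / T))ᶜ, fourierTerm η T N a c q u := by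
          rw [sub_eq_iff_eq_add', hI, hJ]
          exact (integral_add_compl Metric.isClosed_closedBall.measurableSet hint).symm
        rw [h5]
        calc _ ≤ ∫ u in (Metric.closedBall (0 : ℂ) (N ^ ε / T))ᶜ, ‖fourierTerm η T N a c q u‖ :=
              norm_integral_le_integral_norm _
          _ ≤ ∫ u in (Metric.closedBall (0 : ℂ) (N ^ ε / T))ᶜ, M *
                ‖fHat η T (u / (π : ℂ)) (GaussianInt.toComplex q / GaussianInt.toComplex c)‖ :=
              integral_mono_of_nonneg (.of_forall fun u => norm_nonneg _)
                (hfi.const_mul M).integrableOn (.of_forall h4)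
          _ ≤ M * (C * T ^ 4 * (N ^ 12)⁻¹ * ‖GaussianInt.toComplex c‖ ^ 4 *
                (‖GaussianInt.toComplex q‖ ^ 4)⁻¹) := by
              rw [integral_const_mul]
              gcongr
          _ = _ := by ring
      · have h5 : N ^ ε < ‖GaussianInt.toComplex q / GaussianInt.toComplex c‖ := by
          rw [hs, Finset.mem_subtype, mem_puncturedDisc, not_and'] at hq
          rw [norm_div, lt_div_iff₀ hcpos, mul_comm]
          exact not_le.1 (hq q.2)
        rw [sub_zero]
        calc _ ≤ ∫ u, ‖fourierTerm η T N a c q u‖ := norm_integral_le_integral_norm _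
          _ ≤ ∫ u, M *
                ‖fHat η T (u / (π : ℂ)) (GaussianInt.toComplex q / GaussianInt.toComplex c)‖ :=
              integral_mono_of_nonneg (.of_forall fun u => norm_nonneg _)
                (hfi.const_mul M) (.of_forall h4)
          _ ≤ M * (C * T ^ 4 * (N ^ 12)⁻¹ * ‖GaussianInt.toComplex c‖ ^ 4 *
                (‖GaussianInt.toComplex q‖ ^ 4)⁻¹) := by
              rw [integral_const_mul]
              exact mul_le_mul_of_nonneg_left (h1 h5) hM0
          _ = _ := by ring
    have hsummable := summable_inv_norm_pow_four.mul_left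
      (M * (C * T ^ 4 * (N ^ 12)⁻¹) * ‖GaussianInt.toComplex c‖ ^ 4)
    have hJs : Summable fun q : {q : GaussianInt // q ≠ 0} => if q ∈ s then J q else 0 :=
      summable_of_ne_finset_zero (s := s) fun q hq => if_neg hq
    have hIs : Summable I := by
      have := (Summable.of_norm_bounded hsummable hbound).add hJs
      simpa using this
    rw [← mul_sub, hJsum, ← hIs.tsum_sub hJs, norm_mul, norm_real,
      Real.norm_of_nonneg (by positivity)]
    have hle := tsum_of_norm_bounded hsummable.hasSum hbound
    rw [tsum_mul_left] at hle
    calc 1 / ‖GaussianInt.toComplex c‖ ^ 4 * _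
        ≤ 1 / ‖GaussianInt.toComplex c‖ ^ 4 *
          (M * (C * T ^ 4 * (N ^ 12)⁻¹) * ‖GaussianInt.toComplex c‖ ^ 4 * Q) := by gcongr
      _ = _ := by
        rw [hM]
        field_simp
  have hS₀ : S₀ η ε T N X a = ∑ c ∈ puncturedDisc X,
      ((1 / ‖GaussianInt.toComplex c‖ ^ 4 : ℝ) : ℂ) *
        ∑ q ∈ puncturedDisc (‖GaussianInt.toComplex c‖ * N ^ ε),
          ∫ u in Metric.closedBall (0 : ℂ) (N ^ ε / T), fourierTerm η T N a c q u := rfl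
  rw [S_eq_tsum hη hT, hS₀, ← Finset.sum_sub_distrib]
  refine (norm_sum_le _ _).trans ((Finset.sum_le_sum hterm).trans ?_)
  have hcard : ((puncturedDisc X).card : ℝ) ≤ 9 * N ^ 2 := by
    calc ((puncturedDisc X).card : ℝ) ≤ (disc X).card := by
          exact_mod_cast Finset.card_le_card (puncturedDisc_subset_disc X)
      _ ≤ (2 * X + 1) ^ 2 := card_disc_le (by linarith)
      _ ≤ (3 * N) ^ 2 := by
          gcongr
          linarith
      _ = _ := by ring
  calc ∑ c ∈ puncturedDisc X, 2025 * N ^ 2 * normSq a N * (C * T ^ 4 * (N ^ 12)⁻¹) *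
        ‖GaussianInt.toComplex c‖ ^ 4 * Q
      ≤ ∑ c ∈ puncturedDisc X, 2025 * N ^ 2 * normSq a N * (C * N ^ 4 * (N ^ 12)⁻¹) *
        N ^ 4 * Q := by
        refine Finset.sum_le_sum fun c hc => ?_
        have := (mem_puncturedDisc.1 hc).1
        have hTN' := hTN.le
        gcongr
        linarith
    _ = (puncturedDisc X).card * (2025 * N ^ 2 * normSq a N * (C * N ^ 4 * (N ^ 12)⁻¹) *
        N ^ 4 * Q) := by rw [Finset.sum_const, nsmul_eq_mul]
    _ ≤ 9 * N ^ 2 * (2025 * N ^ 2 * normSq a N * (C * N ^ 4 * (N ^ 12)⁻¹) * N ^ 4 * Q) := by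
        gcongr
    -- The losses N² (Cauchy-Schwarz), T⁴ ≤ N⁴, |c|⁴ ≤ N⁴ and 9N² (number of c) multiply to N¹²,
    -- exactly the saving.
    _ = _ := by field_simp

/-- The case k = 2, A = 0: f̂ ≪ T⁴ |c|²/|q|², and |c|⁻⁴ |c|² = |c|⁻². The constant does not depend
on ε. -/
theorem norm_S₀_le {η : ℝ → ℝ} (hη : IsCutoff η) :
    ∃ C, 0 ≤ C ∧ ∀ ε X T N : ℝ, 1 ≤ X → X ≤ T → T < N → ∀ a : Ideal GaussianInt → ℝ,
      ‖S₀ η ε T N X a‖ ≤ C * T ^ 4 * majorant ε T N X a := by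
  obtain ⟨C, hC0, hC⟩ := exists_norm_fHat_le hη (k := 2) le_rfl 0
  refine ⟨C, hC0, fun ε X T N hX hXT hTN a => ?_⟩
  have hT : 1 ≤ T := hX.trans hXT
  have hN : 1 ≤ N := hT.trans hTN.le
  rw [majorant, Finset.mul_sum]
  refine (norm_sum_le _ _).trans (Finset.sum_le_sum fun c hc => ?_)
  have hc0 := (mem_puncturedDisc.1 hc).2
  have hcpos : 0 < ‖GaussianInt.toComplex c‖ := norm_pos_iff.2 (toComplex_ne_zero hc0)
  rw [norm_mul, norm_real, Real.norm_of_nonneg (by positivity), ← mul_assoc, Finset.mul_sum]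
  refine (mul_le_mul_of_nonneg_left (norm_sum_le _ _) (by positivity)).trans ?_
  rw [Finset.mul_sum]
  refine Finset.sum_le_sum fun q hq => ?_
  have hq0 := (mem_puncturedDisc.1 hq).2
  have hqpos : 0 < ‖GaussianInt.toComplex q‖ := norm_pos_iff.2 (toComplex_ne_zero hq0)
  have hv := div_toComplex_ne_zero hc0 hq0
  have hEint : IntegrableOn (fun u => ‖expSum N a c q u‖ ^ 2)
      (Metric.closedBall (0 : ℂ) (N ^ ε / T)) :=
    (by fun_prop : Continuous fun u => ‖expSum N a c q u‖ ^ 2).continuousOn.integrableOn_compact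
      (isCompact_closedBall _ _)
  have hne : ∀ᵐ u : ℂ, u ≠ 0 := by simp [ae_iff]
  have hb : ∀ᵐ u : ℂ ∂(volume.restrict (Metric.closedBall (0 : ℂ) (N ^ ε / T))),
      ‖fHat η T (u / (π : ℂ)) (GaussianInt.toComplex q / GaussianInt.toComplex c) *
        ((‖expSum N a c q u‖ ^ 2 : ℝ) : ℂ)‖ ≤
      C * T ^ 4 * (‖GaussianInt.toComplex c‖ ^ 2 / ‖GaussianInt.toComplex q‖ ^ 2) *
        ‖expSum N a c q u‖ ^ 2 := by
    filter_upwards [ae_restrict_of_ae hne] with u hu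
    have := hC T hT (u / π) _ (div_ne_zero hu pi_ne_zero') hv
    rw [pow_zero, inv_one, mul_one, norm_div, div_pow, inv_div] at this
    rw [norm_mul, norm_real, Real.norm_of_nonneg (by positivity)]
    gcongr
  have h1 := (norm_integral_le_integral_norm _).trans
    (integral_mono_of_nonneg (.of_forall fun u => norm_nonneg _) (hEint.const_mul _) hb)
  rw [integral_const_mul] at h1
  refine (mul_le_mul_of_nonneg_left h1 (by positivity)).trans_eq ?_
  field_simp

end DualSum

/-! ### The large sieve over the Gaussian integers -/

namespace DualSum

open MeasureTheory Complex
open scoped ComplexConjugate Real ENNReal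

/-- Primitive vectors `(c, b)` of `ℤ[i]²` in the box `|c| ≤ X`, `|c x - b| ≤ δ` are `O (1 + X δ)²`
in number. -/
theorem card_primitive_le {X δ : ℝ} (hX : 0 < X) (hδ : 0 < δ) (x : ℂ)
    (F : Finset (GaussianInt × GaussianInt))
    (hF : ∀ p ∈ F, p.1 ≠ 0 ∧ IsCoprime p.1 p.2 ∧ ‖GaussianInt.toComplex p.1‖ ≤ X ∧
      ‖GaussianInt.toComplex p.1 * x - GaussianInt.toComplex p.2‖ ≤ δ) :
    (F.card : ℝ) ≤ 25 * (4 * (X * δ) + 1) ^ 2 := by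
  classical
  rcases F.eq_empty_or_nonempty with rfl | hne
  · simp
    positivity
  -- Take p₀ of maximal size in the norm adapted to the box. Vectors are sorted by their determinant
  -- against p₀, which is at most 2Xδ in modulus. As p₀ is primitive, two vectors with equal
  -- determinant differ by a multiple t p₀.
  obtain ⟨p₀, hp₀, hmax⟩ := F.exists_max_image (fun p => max (‖GaussianInt.toComplex p.1‖ / X)
    (‖GaussianInt.toComplex p.1 * x - GaussianInt.toComplex p.2‖ / δ)) hne
  obtain ⟨h0, hcop, hX0, hδ0⟩ := hF p₀ hp₀
  set μ := max (‖GaussianInt.toComplex p₀.1‖ / X)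
    (‖GaussianInt.toComplex p₀.1 * x - GaussianInt.toComplex p₀.2‖ / δ) with hμ
  have hμpos : 0 < μ :=
    lt_max_of_lt_left (div_pos (norm_pos_iff.2 (toComplex_ne_zero h0)) hX)
  have h1 : ∀ p ∈ F, ‖GaussianInt.toComplex p.1‖ ≤ X * μ := fun p hp => by
    have := (le_max_left _ _).trans (hmax p hp)
    rwa [div_le_iff₀' hX] at this
  have h2 : ∀ p ∈ F, ‖GaussianInt.toComplex p.1 * x - GaussianInt.toComplex p.2‖ ≤ δ * μ :=
    fun p hp => by
      have := (le_max_right _ _).trans (hmax p hp)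
      rwa [div_le_iff₀' hδ] at this
  let det : GaussianInt × GaussianInt → GaussianInt := fun p => p₀.1 * p.2 - p.1 * p₀.2
  have hdet : F.image det ⊆ disc (2 * (X * δ)) := by
    intro d hd
    obtain ⟨p, hp, rfl⟩ := Finset.mem_image.1 hd
    obtain ⟨-, -, hXp, hδp⟩ := hF p hp
    rw [mem_disc]
    have h3 : GaussianInt.toComplex (det p) =
        GaussianInt.toComplex p.1 * (GaussianInt.toComplex p₀.1 * x - GaussianInt.toComplex p₀.2) -
        GaussianInt.toComplex p₀.1 * (GaussianInt.toComplex p.1 * x - GaussianInt.toComplex p.2) := by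
      simp only [det, GaussianInt.toComplex_sub, GaussianInt.toComplex_mul]
      ring
    rw [h3]
    refine (norm_sub_le _ _).trans ?_
    rw [norm_mul, norm_mul, two_mul]
    gcongr
  have hfib : ∀ d ∈ F.image det, (F.filter fun p => det p = d).card ≤ 25 := by
    intro d hd
    obtain ⟨p₁, hp₁, hd₁⟩ := Finset.mem_image.1 hd
    have hex : ∀ p ∈ F.filter fun p => det p = d, ∃ t : GaussianInt,
        p.1 = p₁.1 + t * p₀.1 ∧ p.2 = p₁.2 + t * p₀.2 := by
      intro p hp
      have hp' := (Finset.mem_filter.1 hp).2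
      have h3 : p₀.1 * (p.2 - p₁.2) = (p.1 - p₁.1) * p₀.2 := by
        have : det p = det p₁ := hp'.trans hd₁.symm
        simp only [det] at this
        linear_combination this
      obtain ⟨t, ht⟩ := hcop.dvd_of_dvd_mul_right (Dvd.intro _ h3)
      refine ⟨t, by linear_combination ht, ?_⟩
      have h4 : p₀.1 * (p.2 - p₁.2) = p₀.1 * (t * p₀.2) := by
        rw [h3, ht]
        ring
      linear_combination mul_left_cancel₀ h0 h4
    choose! t ht using hex
    have hinj : Set.InjOn t (F.filter fun p => det p = d : Finset _) := by
      intro p hp p' hp' htt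
      obtain ⟨e1, e2⟩ := ht p hp
      obtain ⟨e1', e2'⟩ := ht p' hp'
      rw [← htt] at e1' e2'
      exact Prod.ext (e1.trans e1'.symm) (e2.trans e2'.symm)
    have hmaps : ∀ p ∈ F.filter (fun p => det p = d), t p ∈ disc 2 := by
      intro p hp
      obtain ⟨e1, e2⟩ := ht p hp
      have hpF := (Finset.mem_filter.1 hp).1
      rw [mem_disc]
      have key : ‖GaussianInt.toComplex (t p)‖ * ‖GaussianInt.toComplex p₀.1‖ ≤ 2 * (X * μ) := by
        rw [← norm_mul, ← GaussianInt.toComplex_mul, ← sub_eq_iff_eq_add'.2 e1,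
          GaussianInt.toComplex_sub]
        refine (norm_sub_le _ _).trans ?_
        linarith [h1 p hpF, h1 p₁ hp₁]
      have key' : ‖GaussianInt.toComplex (t p)‖ *
          ‖GaussianInt.toComplex p₀.1 * x - GaussianInt.toComplex p₀.2‖ ≤ 2 * (δ * μ) := by
        have h5 : GaussianInt.toComplex (t p) *
            (GaussianInt.toComplex p₀.1 * x - GaussianInt.toComplex p₀.2) =
            (GaussianInt.toComplex p.1 * x - GaussianInt.toComplex p.2) -
            (GaussianInt.toComplex p₁.1 * x - GaussianInt.toComplex p₁.2) := by
          rw [e1, e2]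
          simp only [GaussianInt.toComplex_add, GaussianInt.toComplex_mul]
          ring
        rw [← norm_mul, h5]
        refine (norm_sub_le _ _).trans ?_
        linarith [h2 p hpF, h2 p₁ hp₁]
      -- Whichever coordinate attains the size μ of p₀, dividing by it gives |t| ≤ 2; the disc of
      -- radius 2 contains at most (2 · 2 + 1)² = 25 lattice points.
      rcases max_choice (‖GaussianInt.toComplex p₀.1‖ / X)
        (‖GaussianInt.toComplex p₀.1 * x - GaussianInt.toComplex p₀.2‖ / δ) with hm | hm
      · rw [← hμ, eq_div_iff hX.ne', mul_comm] at hm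
        rw [← hm] at key
        exact le_of_mul_le_mul_right key (by positivity)
      · rw [← hμ, eq_div_iff hδ.ne', mul_comm] at hm
        rw [← hm] at key'
        exact le_of_mul_le_mul_right key' (by positivity)
    have h6 := Finset.card_le_card_of_injOn t hmaps hinj
    have h7 := card_disc_le (R := 2) (by norm_num)
    have h8 : ((disc 2).card : ℝ) ≤ (25 : ℕ) := by
      push_cast
      linarith
    exact h6.trans (by exact_mod_cast h8)
  have h9 := Finset.card_le_mul_card_image F 25 hfib
  have h10 := card_disc_le (R := 2 * (X * δ)) (by positivity)
  calc (F.card : ℝ) ≤ 25 * (F.image det).card := by exact_mod_cast h9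
    _ ≤ 25 * (disc (2 * (X * δ))).card := by
        gcongr
    _ ≤ 25 * (2 * (2 * (X * δ)) + 1) ^ 2 := by gcongr
    _ = _ := by ring

/-- The lattice `ℤ[i]` as an additive subgroup of `ℂ`. -/
noncomputable def gaussLattice : AddSubgroup ℂ := GaussianInt.toComplex.toAddMonoidHom.range

/-- The half-open unit square. -/
def unitSquare : Set ℂ := {z | z.re ∈ Set.Ico (0 : ℝ) 1 ∧ z.im ∈ Set.Ico (0 : ℝ) 1}

theorem unitSquare_eq : unitSquare =
    Complex.measurableEquivRealProd ⁻¹' (Set.Ico (0 : ℝ) 1 ×ˢ Set.Ico (0 : ℝ) 1) := rfl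

theorem measurableSet_unitSquare : MeasurableSet unitSquare :=
  Complex.measurableEquivRealProd.measurable (measurableSet_Ico.prod measurableSet_Ico)

instance countable_gaussianInt : Countable GaussianInt := by
  refine Function.Injective.countable (f := fun n : GaussianInt => (n.re, n.im)) fun x y hxy => ?_
  simp only [Prod.mk.injEq] at hxy
  exact Zsqrtd.ext hxy.1 hxy.2

instance countable_gaussLattice : Countable gaussLattice :=
  (Set.countable_range GaussianInt.toComplex).to_subtype

theorem isAddFundamentalDomain_unitSquare :
    IsAddFundamentalDomain gaussLattice unitSquare volume := by
  refine IsAddFundamentalDomain.mk' measurableSet_unitSquare.nullMeasurableSet fun x => ?_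
  refine ⟨⟨GaussianInt.toComplex ⟨-⌊x.re⌋, -⌊x.im⌋⟩, ⟨_, rfl⟩⟩, ?_, ?_⟩
  · simp only [unitSquare, Set.mem_Ico, AddSubgroup.vadd_def, vadd_eq_add]
    constructor
    · rw [add_re, GaussianInt.re_toComplex]
      push_cast
      exact ⟨by linarith [Int.floor_le x.re], by linarith [Int.lt_floor_add_one x.re]⟩
    · rw [add_im, GaussianInt.im_toComplex]
      push_cast
      exact ⟨by linarith [Int.floor_le x.im], by linarith [Int.lt_floor_add_one x.im]⟩
  · rintro ⟨_, ⟨k, rfl⟩⟩ hk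
    have hk' : (GaussianInt.toComplex k + x) ∈ unitSquare := hk
    obtain ⟨⟨h1, h2⟩, ⟨h3, h4⟩⟩ := hk'
    rw [add_re, ← GaussianInt.intCast_re] at h1 h2
    rw [add_im, ← GaussianInt.intCast_im] at h3 h4
    have h5 : ⌊x.re⌋ = -k.re := Int.floor_eq_iff.2 (by
      push_cast
      exact ⟨by linarith, by linarith⟩)
    have h6 : ⌊x.im⌋ = -k.im := Int.floor_eq_iff.2 (by
      push_cast
      exact ⟨by linarith, by linarith⟩)
    refine Subtype.ext (congrArg GaussianInt.toComplex ?_)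
    rw [h5, h6, neg_neg, neg_neg]

theorem integral_exp_int_eq_zero {k : ℤ} (hk : k ≠ 0) :
    ∫ x in Set.Ico (0 : ℝ) 1, Complex.exp (2 * π * I * k * x) = 0 := by
  have hc : 2 * (π : ℂ) * I * k ≠ 0 := by
    simp [Real.pi_ne_zero, hk]
  rw [integral_Ico_eq_integral_Ioo, ← integral_Ioc_eq_integral_Ioo,
    ← intervalIntegral.integral_of_le zero_le_one, integral_exp_mul_complex hc]
  have : Complex.exp (2 * (π : ℂ) * I * k) = 1 :=
    Complex.exp_eq_one_iff.2 ⟨k, by ring⟩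
  simp [this]

theorem integral_unitSquare_e (k : GaussianInt) :
    ∫ x in unitSquare, e (GaussianInt.toComplex k * x) = if k = 0 then 1 else 0 := by
  have hprod : ∫ x in unitSquare, e (GaussianInt.toComplex k * x) =
      (∫ x in Set.Ico (0 : ℝ) 1, Complex.exp (2 * π * I * k.re * x)) *
        ∫ y in Set.Ico (0 : ℝ) 1, Complex.exp (2 * π * I * (-k.im : ℤ) * y) := by
    rw [← setIntegral_prod_mul, unitSquare_eq, ← Measure.volume_eq_prod]
    rw [← Complex.volume_preserving_equiv_real_prod.setIntegral_preimage_emb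
      Complex.measurableEquivRealProd.measurableEmbedding]
    refine integral_congr_ae (.of_forall fun z => ?_)
    simp only [Complex.measurableEquivRealProd_apply]
    rw [e, ← Complex.exp_add, mul_re, ← GaussianInt.intCast_re, ← GaussianInt.intCast_im]
    congr 1
    push_cast
    ring
  rw [hprod]
  split_ifs with hk
  · subst hk
    simp
  · rcases eq_or_ne k.re 0 with h1 | h1
    · have h2 : -k.im ≠ 0 := fun h2 => hk (Zsqrtd.ext h1 (neg_eq_zero.1 h2))
      rw [integral_exp_int_eq_zero h2, mul_zero]
    · rw [integral_exp_int_eq_zero h1, zero_mul]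

/-- The exponential polynomial `∑ aₙ e[n x]`. -/
noncomputable def expPoly (N : ℝ) (a : Ideal GaussianInt → ℝ) (x : ℂ) : ℂ :=
  ∑ n ∈ annulus N, (a (Ideal.span {n}) : ℂ) * e (GaussianInt.toComplex n * x)

@[fun_prop]
theorem continuous_expPoly (N : ℝ) (a : Ideal GaussianInt → ℝ) : Continuous (expPoly N a) := by
  unfold expPoly
  fun_prop

theorem expPoly_add_lattice (N : ℝ) (a : Ideal GaussianInt → ℝ) (k : gaussLattice) (x : ℂ) :
    expPoly N a (k +ᵥ x) = expPoly N a x := by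
  obtain ⟨_, ⟨k, rfl⟩⟩ := k
  refine Finset.sum_congr rfl fun n _ => ?_
  congr 1
  change e (GaussianInt.toComplex n * (GaussianInt.toComplex k + x)) = _
  rw [mul_add, e_add, ← GaussianInt.toComplex_mul, e_gaussianInt, one_mul]

theorem isBounded_unitSquare : Bornology.IsBounded unitSquare := by
  refine (Metric.isBounded_closedBall (x := (0 : ℂ)) (r := 2)).subset fun z hz => ?_
  rw [mem_closedBall_zero_iff]
  refine (Complex.norm_le_abs_re_add_abs_im z).trans ?_
  obtain ⟨⟨h1, h2⟩, h3, h4⟩ := hz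
  rw [abs_of_nonneg h1, abs_of_nonneg h3]
  linarith

theorem integrableOn_unitSquare {E : Type*} [NormedAddCommGroup E] {F : ℂ → E}
    (hF : Continuous F) : IntegrableOn F unitSquare :=
  (hF.continuousOn.integrableOn_compact
    (Metric.isCompact_of_isClosed_isBounded isClosed_closure isBounded_unitSquare.closure)).mono_set
    subset_closure

/-- Parseval: characters attached to distinct Gaussian integers are orthogonal on the unit square.
-/
theorem integral_unitSquare_sq_norm_expPoly (N : ℝ) (a : Ideal GaussianInt → ℝ) :
    ∫ x in unitSquare, ‖expPoly N a x‖ ^ 2 = normSq a N := by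
  have h1 : ∀ x, ((‖expPoly N a x‖ ^ 2 : ℝ) : ℂ) = ∑ m ∈ annulus N, ∑ n ∈ annulus N,
      (a (Ideal.span {m}) : ℂ) * (a (Ideal.span {n}) : ℂ) *
        e (GaussianInt.toComplex (m - n) * x) := by
    intro x
    rw [← Complex.normSq_eq_norm_sq, Complex.normSq_eq_conj_mul_self, mul_comm, expPoly, map_sum,
      Finset.sum_mul_sum]
    refine Finset.sum_congr rfl fun m _ => Finset.sum_congr rfl fun n _ => ?_
    have h2 : GaussianInt.toComplex (m - n) * x =
        GaussianInt.toComplex m * x + -(GaussianInt.toComplex n * x) := by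
      rw [GaussianInt.toComplex_sub]
      ring
    rw [h2, e_add, e_neg, map_mul, conj_ofReal]
    ring
  have hint : ∀ m n : GaussianInt, IntegrableOn (fun x : ℂ =>
      (a (Ideal.span {m}) : ℂ) * (a (Ideal.span {n}) : ℂ) *
        e (GaussianInt.toComplex (m - n) * x)) unitSquare :=
    fun m n => integrableOn_unitSquare (by fun_prop)
  rw [← ofReal_inj, ← integral_complex_ofReal, integral_congr_ae (.of_forall h1),
    integral_finsetSum _ fun m _ => integrable_finsetSum _ fun n _ => hint m n, normSq]
  push_cast
  refine Finset.sum_congr rfl fun m hm => ?_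
  rw [integral_finsetSum _ fun n _ => hint m n]
  simp_rw [integral_const_mul, integral_unitSquare_e, sub_eq_zero]
  simp only [mul_ite, mul_one, mul_zero, Finset.sum_ite_eq, if_pos hm]
  rw [← ofReal_mul, ← sq, ← sq_abs, ofReal_pow]

/-- `|A(x)|²` for the exponential polynomial `A`, as an extended nonnegative real. -/
noncomputable def expWeight (N : ℝ) (a : Ideal GaussianInt → ℝ) (x : ℂ) : ℝ≥0∞ :=
  ENNReal.ofReal (‖expPoly N a x‖ ^ 2)

theorem measurable_expWeight (N : ℝ) (a : Ideal GaussianInt → ℝ) : Measurable (expWeight N a) :=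
  (by fun_prop : Continuous fun x => ‖expPoly N a x‖ ^ 2).measurable.ennreal_ofReal

theorem lintegral_unitSquare_expWeight (N : ℝ) (a : Ideal GaussianInt → ℝ) :
    ∫⁻ x in unitSquare, expWeight N a x = ENNReal.ofReal (normSq a N) := by
  rw [← integral_unitSquare_sq_norm_expPoly, ofReal_integral_eq_lintegral_ofReal
    (integrableOn_unitSquare (by fun_prop)) (.of_forall fun x => by positivity)]
  rfl

/-- The reduced fractions with denominator in a disc: pairs of a modulus `c` with `0 < |c| ≤ X` and
an invertible residue class modulo `c`. -/
abbrev Farey (X : ℝ) : Type := Σ c : puncturedDisc X, (Residue (c : GaussianInt))ˣ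

/-- The set of `x` with `|c x - α| ≤ δ`. -/
def arc {X : ℝ} (δ : ℝ) (i : Farey X) : Set ℂ :=
  {x | ‖GaussianInt.toComplex i.1 * x -
    GaussianInt.toComplex (Quotient.out (i.2 : Residue (i.1 : GaussianInt)))‖ ≤ δ}

theorem measurableSet_arc {X : ℝ} (δ : ℝ) (i : Farey X) : MeasurableSet (arc δ i) :=
  (isClosed_le (by fun_prop) continuous_const).measurableSet

theorem isCoprime_out {c : GaussianInt} (α : (Residue c)ˣ) :
    IsCoprime c (Quotient.out (α : Residue c)) := by
  have h1 : Ideal.Quotient.mk (Ideal.span {c})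
      (Quotient.out (α : Residue c) * Quotient.out ((α⁻¹ : (Residue c)ˣ) : Residue c)) =
      Ideal.Quotient.mk (Ideal.span {c}) 1 := by
    rw [map_mul, mk_out, mk_out, Units.mul_inv, map_one]
  rw [Ideal.Quotient.eq, Ideal.mem_span_singleton] at h1
  obtain ⟨s, hs⟩ := h1
  exact ⟨-s, Quotient.out ((α⁻¹ : (Residue c)ˣ) : Residue c), by linear_combination hs⟩

/-- The overlap of the discs modulo ℤ[i]. A fraction α/c and a translate k with x + k in its disc
give the primitive vector (c, α - c k), and distinct pairs give distinct vectors, so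
`card_primitive_le` applies. -/
theorem tsum_indicator_arc_le {X δ : ℝ} (hX : 0 < X) (hδ : 0 < δ) (x : ℂ) :
    ∑' p : Farey X × gaussLattice, (arc δ p.1).indicator (fun _ => (1 : ℝ≥0∞)) (p.2 +ᵥ x) ≤
      ENNReal.ofReal (25 * (4 * (X * δ) + 1) ^ 2) := by
  classical
  rw [ENNReal.tsum_eq_iSup_sum]
  refine iSup_le fun F => ?_
  simp only [Set.indicator_apply]
  rw [Finset.sum_boole, ← ENNReal.ofReal_natCast]
  refine ENNReal.ofReal_le_ofReal ?_
  set F' := F.filter fun p => p.2 +ᵥ x ∈ arc δ p.1 with hF'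
  choose κ hκ using fun k : gaussLattice => k.2
  have hκ' : ∀ k : gaussLattice, GaussianInt.toComplex (κ k) = k := hκ
  let g : Farey X × gaussLattice → GaussianInt × GaussianInt := fun p =>
    ((p.1.1 : GaussianInt), Quotient.out (p.1.2 : Residue (p.1.1 : GaussianInt)) - (p.1.1 : GaussianInt) * κ p.2)
  have hg : Function.Injective g := by
    rintro ⟨⟨c, α⟩, k⟩ ⟨⟨c', α'⟩, k'⟩ hgg
    simp only [g, Prod.mk.injEq] at hgg
    obtain ⟨h1, h2⟩ := hgg
    obtain rfl := Subtype.ext h1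
    have hα : α = α' := by
      refine Units.ext ?_
      rw [← mk_out (α : Residue (c : GaussianInt)), ← mk_out (α' : Residue (c : GaussianInt)),
        Ideal.Quotient.eq, Ideal.mem_span_singleton]
      exact ⟨κ k - κ k', by linear_combination h2⟩
    subst hα
    have hc := (mem_puncturedDisc.1 c.2).2
    have h3 : κ k = κ k' := mul_left_cancel₀ hc (by linear_combination -h2)
    have h4 : k = k' := Subtype.ext (by rw [← hκ' k, ← hκ' k', h3])
    rw [h4]
  rw [← Finset.card_image_of_injective F' hg]
  refine card_primitive_le hX hδ x _ fun p hp => ?_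
  obtain ⟨⟨⟨c, α⟩, k⟩, hq, rfl⟩ := Finset.mem_image.1 hp
  have hc := mem_puncturedDisc.1 c.2
  have harc : k +ᵥ x ∈ arc δ ⟨c, α⟩ := (Finset.mem_filter.1 hq).2
  refine ⟨hc.2, ?_, hc.1, ?_⟩
  · have := (isCoprime_out α).add_mul_left_right (-κ k)
    simpa [g, sub_eq_add_neg] using this
  · change ‖GaussianInt.toComplex c * ((k : ℂ) + x) - _‖ ≤ δ at harc
    rw [← hκ' k] at harc
    simp only [g, GaussianInt.toComplex_sub, GaussianInt.toComplex_mul]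
    convert harc using 2
    ring

theorem countable_farey (X : ℝ) : Countable (Farey X) := by
  have : ∀ c : puncturedDisc X, Countable (Residue (c : GaussianInt))ˣ := fun c =>
    have : Countable (Residue (c : GaussianInt)) := Ideal.Quotient.mk_surjective.countable
    (Units.val_injective (α := Residue (c : GaussianInt))).countable
  infer_instance

/-- The large sieve inequality over `ℤ[i]`. -/
theorem large_sieve {X δ : ℝ} (hX : 0 < X) (hδ : 0 < δ) (N : ℝ) (a : Ideal GaussianInt → ℝ) :
    ∑' i : Farey X, ∫⁻ x in arc δ i, expWeight N a x ≤
      ENNReal.ofReal (25 * (4 * (X * δ) + 1) ^ 2 * normSq a N) := by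
  have := countable_farey X
  have hw := measurable_expWeight N a
  have h1 : ∀ i : Farey X, ∫⁻ x in arc δ i, expWeight N a x = ∑' k : gaussLattice,
      ∫⁻ x in unitSquare, (arc δ i).indicator (fun _ => (1 : ℝ≥0∞)) (k +ᵥ x) * expWeight N a x := by
    intro i
    rw [← lintegral_indicator (measurableSet_arc δ i),
      isAddFundamentalDomain_unitSquare.lintegral_eq_tsum'']
    refine tsum_congr fun k => lintegral_congr fun x => ?_
    have h2 : expWeight N a (k +ᵥ x) = expWeight N a x := by
      rw [expWeight, expPoly_add_lattice, expWeight]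
    by_cases h : k +ᵥ x ∈ arc δ i
    · rw [Set.indicator_of_mem h, Set.indicator_of_mem h, one_mul, h2]
    · rw [Set.indicator_of_notMem h, Set.indicator_of_notMem h, zero_mul]
  have hm : ∀ p : Farey X × gaussLattice, Measurable fun x : ℂ =>
      (arc δ p.1).indicator (fun _ => (1 : ℝ≥0∞)) (p.2 +ᵥ x) := fun p =>
    (measurable_const.indicator (measurableSet_arc δ p.1)).comp
      (continuous_const_vadd p.2).measurable
  -- Folding every disc into the fundamental square by periodicity of A turns the sum into an
  -- integral of |A|² against the overlap count; the uniform bound for the count and Parseval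
  -- finish.
  calc ∑' i : Farey X, ∫⁻ x in arc δ i, expWeight N a x
      = ∑' p : Farey X × gaussLattice, ∫⁻ x in unitSquare,
          (arc δ p.1).indicator (fun _ => (1 : ℝ≥0∞)) (p.2 +ᵥ x) * expWeight N a x := by
        rw [ENNReal.tsum_prod']
        exact tsum_congr h1
    _ = ∫⁻ x in unitSquare, (∑' p : Farey X × gaussLattice,
          (arc δ p.1).indicator (fun _ => (1 : ℝ≥0∞)) (p.2 +ᵥ x)) * expWeight N a x := by
        simp_rw [← ENNReal.tsum_mul_right]
        exact (lintegral_tsum fun p => ((hm p).mul hw).aemeasurable).symm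
    _ ≤ ∫⁻ x in unitSquare, ENNReal.ofReal (25 * (4 * (X * δ) + 1) ^ 2) * expWeight N a x := by
        refine lintegral_mono fun x => ?_
        gcongr
        exact tsum_indicator_arc_le hX hδ x
    _ = _ := by
        rw [lintegral_const_mul _ hw, lintegral_unitSquare_expWeight,
          ← ENNReal.ofReal_mul (by positivity)]

/-! ### From the large sieve to the final bound -/

theorem lintegral_closedBall_expWeight {X δ : ℝ} (i : Farey X) (N : ℝ)
    (a : Ideal GaussianInt → ℝ) :
    ∫⁻ u in Metric.closedBall (0 : ℂ) δ, expWeight N a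
      ((GaussianInt.toComplex (Quotient.out (i.2 : Residue (i.1 : GaussianInt))) + u) /
        GaussianInt.toComplex i.1) =
      ENNReal.ofReal (‖GaussianInt.toComplex i.1‖ ^ 2) * ∫⁻ x in arc δ i, expWeight N a x := by
  have hc := toComplex_ne_zero (mem_puncturedDisc.1 i.1.2).2
  set c := GaussianInt.toComplex i.1
  set b := GaussianInt.toComplex (Quotient.out (i.2 : Residue (i.1 : GaussianInt))) with hb
  set F : ℂ → ℝ≥0∞ := (Metric.closedBall (0 : ℂ) δ).indicator fun u => expWeight N a ((b + u) / c)
  have h1 := lintegral_comp_mul_left (fun y => F (y - b)) hc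
  rw [lintegral_sub_right_eq_self] at h1
  have hpos : 0 < ‖c‖ ^ 2 := by
    have := norm_pos_iff.2 hc
    positivity
  rw [← lintegral_indicator Metric.isClosed_closedBall.measurableSet,
    ← lintegral_indicator (measurableSet_arc δ i)]
  have h2 : ∀ x, F (c * x - b) = (arc δ i).indicator (expWeight N a) x := by
    intro x
    by_cases hx : x ∈ arc δ i
    · have hx' : c * x - b ∈ Metric.closedBall (0 : ℂ) δ := mem_closedBall_zero_iff.2 hx
      rw [Set.indicator_of_mem hx]
      refine (Set.indicator_of_mem hx' _).trans ?_
      rw [add_sub_cancel, mul_div_cancel_left₀ x hc]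
    · have hx' : c * x - b ∉ Metric.closedBall (0 : ℂ) δ := fun h => hx (mem_closedBall_zero_iff.1 h)
      rw [Set.indicator_of_notMem hx]
      exact Set.indicator_of_notMem hx' _
  simp_rw [h2] at h1
  rw [h1, ← mul_assoc, ← ENNReal.ofReal_mul hpos.le, mul_inv_cancel₀ hpos.ne', ENNReal.ofReal_one,
    one_mul]

/-- Opening the Kloosterman sum: n occurs only in e[n (α + u)/c], while q is confined to a factor of
modulus 1. -/
theorem expSum_eq (N : ℝ) (a : Ideal GaussianInt → ℝ) {c : GaussianInt} [Fintype (Residue c)ˣ]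
    (q : GaussianInt) (u : ℂ) :
    expSum N a c q u = ∑ α : (Residue c)ˣ,
      e (GaussianInt.toComplex (Quotient.out ((α⁻¹ : (Residue c)ˣ) : Residue c) * q) /
        GaussianInt.toComplex c) *
      expPoly N a ((GaussianInt.toComplex (Quotient.out (α : Residue c)) + u) /
        GaussianInt.toComplex c) := by
  simp_rw [expSum, kloosterman_eq_sum, expPoly, Finset.mul_sum, Finset.sum_mul]
  rw [Finset.sum_comm]
  refine Finset.sum_congr rfl fun α _ => Finset.sum_congr rfl fun n _ => ?_
  have h1 : GaussianInt.toComplex n * ((GaussianInt.toComplex (Quotient.out (α : Residue c)) + u) /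
      GaussianInt.toComplex c) =
      GaussianInt.toComplex (Quotient.out (α : Residue c) * n) / GaussianInt.toComplex c +
      GaussianInt.toComplex n / GaussianInt.toComplex c * u := by
    rw [GaussianInt.toComplex_mul]
    ring
  rw [h1, e_add, GaussianInt.toComplex_add, add_div, e_add]
  ring

/-- Cauchy-Schwarz over the at most 9|c|² units. The bound no longer involves q, so the sum over q
costs only ∑ |q|⁻². -/
theorem ofReal_sq_norm_expSum_le (N : ℝ) (a : Ideal GaussianInt → ℝ) {c : GaussianInt}
    (hc : c ≠ 0) (q : GaussianInt) (u : ℂ) :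
    ENNReal.ofReal (‖expSum N a c q u‖ ^ 2) ≤
      ENNReal.ofReal (9 * ‖GaussianInt.toComplex c‖ ^ 2) * ∑' α : (Residue c)ˣ,
        expWeight N a ((GaussianInt.toComplex (Quotient.out (α : Residue c)) + u) /
          GaussianInt.toComplex c) := by
  have := finite_residue hc
  have := Fintype.ofFinite (Residue c)ˣ
  rw [tsum_fintype]
  simp only [expWeight]
  rw [← ENNReal.ofReal_sum_of_nonneg fun _ _ => by positivity,
    ← ENNReal.ofReal_mul (by positivity)]
  refine ENNReal.ofReal_le_ofReal ?_
  rw [expSum_eq]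
  refine (pow_le_pow_left₀ (norm_nonneg _) (norm_sum_le _ _) 2).trans ?_
  refine sq_sum_le_card_mul_sum_sq.trans ?_
  have hcard := card_units_le hc
  rw [Nat.card_eq_fintype_card] at hcard
  simp only [norm_mul, norm_e, one_mul, Finset.card_univ]
  gcongr

/-- `∑ |q|⁻² ≪ R^κ` over `0 < |q| ≤ R`. -/
theorem exists_sum_inv_sq_le {κ : ℝ} (hκ : 0 < κ) : ∃ C, 0 ≤ C ∧ ∀ R : ℝ, 0 ≤ R →
    ∑ q ∈ puncturedDisc R, 1 / ‖GaussianInt.toComplex q‖ ^ 2 ≤ C * R ^ κ := by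
  have hs := summable_norm_rpow_neg (r := 2 + κ) (by linarith)
  refine ⟨∑' q : {q : GaussianInt // q ≠ 0}, ‖GaussianInt.toComplex q‖ ^ (-(2 + κ)),
    tsum_nonneg fun q => Real.rpow_nonneg (norm_nonneg _) _, fun R hR => ?_⟩
  -- Rankin's trick: |q|^κ ≤ R^κ makes the remaining series ∑ |q|^(-2-κ) convergent.
  have h1 : ∀ q ∈ puncturedDisc R, 1 / ‖GaussianInt.toComplex q‖ ^ 2 ≤
      ‖GaussianInt.toComplex q‖ ^ (-(2 + κ)) * R ^ κ := by
    intro q hq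
    obtain ⟨hqR, hq0⟩ := mem_puncturedDisc.1 hq
    have hpos : 0 < ‖GaussianInt.toComplex q‖ := norm_pos_iff.2 (toComplex_ne_zero hq0)
    have h2 : 1 / ‖GaussianInt.toComplex q‖ ^ 2 =
        ‖GaussianInt.toComplex q‖ ^ (-(2 + κ)) * ‖GaussianInt.toComplex q‖ ^ κ := by
      rw [← Real.rpow_add hpos, one_div, ← Real.rpow_natCast, ← Real.rpow_neg hpos.le]
      congr 1
      push_cast
      ring
    rw [h2]
    gcongr
  refine (Finset.sum_le_sum h1).trans ?_
  rw [← Finset.sum_mul]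
  gcongr
  rw [← Finset.sum_subtype_of_mem (fun q => ‖GaussianInt.toComplex q‖ ^ (-(2 + κ)))
    (p := fun q : GaussianInt => q ≠ 0) fun q hq => (mem_puncturedDisc.1 hq).2]
  exact hs.sum_le_tsum _ fun q _ => Real.rpow_nonneg (norm_nonneg _) _

/-- The total weight of the discs around the fractions with denominator `c`. -/
noncomputable def discWeight (N δ : ℝ) (a : Ideal GaussianInt → ℝ) (c : GaussianInt) : ℝ≥0∞ :=
  ∑' α : (Residue c)ˣ, ∫⁻ u in Metric.closedBall (0 : ℂ) δ, expWeight N a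
    ((GaussianInt.toComplex (Quotient.out (α : Residue c)) + u) / GaussianInt.toComplex c)

/-- Passing from u to x = (α + u)/c has Jacobian |c|² ≤ X²; this is the origin of the X² in the
final bound. -/
theorem sum_discWeight_le {X δ : ℝ} (hX : 0 < X) (hδ : 0 < δ) (N : ℝ) (a : Ideal GaussianInt → ℝ) :
    ∑ c ∈ puncturedDisc X, discWeight N δ a c ≤
      ENNReal.ofReal (X ^ 2 * (25 * (4 * (X * δ) + 1) ^ 2 * normSq a N)) := by
  rw [← Finset.sum_coe_sort, ← tsum_fintype (L := .unconditional _)]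
  simp only [discWeight]
  rw [← ENNReal.tsum_sigma'
    fun i : Farey X => ∫⁻ u in Metric.closedBall (0 : ℂ) δ, expWeight N a
      ((GaussianInt.toComplex (Quotient.out (i.2 : Residue (i.1 : GaussianInt))) + u) /
        GaussianInt.toComplex i.1)]
  rw [ENNReal.ofReal_mul (by positivity)]
  refine le_trans ?_ (mul_le_mul_right (large_sieve hX hδ N a) _)
  rw [← ENNReal.tsum_mul_left]
  refine ENNReal.tsum_le_tsum fun i => ?_
  rw [lintegral_closedBall_expWeight]
  gcongr
  exact (mem_puncturedDisc.1 i.1.2).1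

theorem ofReal_integral_sq_norm_expSum_le (N δ : ℝ) (a : Ideal GaussianInt → ℝ) {c : GaussianInt}
    (hc : c ≠ 0) (q : GaussianInt) :
    ENNReal.ofReal (∫ u in Metric.closedBall (0 : ℂ) δ, ‖expSum N a c q u‖ ^ 2) ≤
      ENNReal.ofReal (9 * ‖GaussianInt.toComplex c‖ ^ 2) * discWeight N δ a c := by
  have := finite_residue hc
  have hcont := continuous_expSum N a c q
  have hint : IntegrableOn (fun u => ‖expSum N a c q u‖ ^ 2) (Metric.closedBall (0 : ℂ) δ) :=
    (by fun_prop : Continuous fun u => ‖expSum N a c q u‖ ^ 2).continuousOn.integrableOn_compact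
      (isCompact_closedBall _ _)
  have hm : ∀ α : (Residue c)ˣ, Measurable fun u : ℂ => expWeight N a
      ((GaussianInt.toComplex (Quotient.out (α : Residue c)) + u) / GaussianInt.toComplex c) :=
    fun α => (measurable_expWeight N a).comp (by fun_prop)
  rw [ofReal_integral_eq_lintegral_ofReal hint (.of_forall fun u => by positivity), discWeight,
    ← lintegral_tsum fun α => (hm α).aemeasurable,
    ← lintegral_const_mul _ (Measurable.tsum hm)]
  exact lintegral_mono fun u => ofReal_sq_norm_expSum_le N a hc q u

theorem discWeight_ne_top {X δ : ℝ} (hX : 0 < X) (hδ : 0 < δ) (N : ℝ) (a : Ideal GaussianInt → ℝ)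
    {c : GaussianInt} (hc : c ∈ puncturedDisc X) : discWeight N δ a c ≠ ∞ :=
  ne_top_of_le_ne_top ENNReal.ofReal_ne_top
    ((Finset.single_le_sum (f := discWeight N δ a) (fun _ _ => zero_le) hc).trans
      (sum_discWeight_le hX hδ N a))

theorem sum_toReal_discWeight_le {X δ : ℝ} (hX : 0 < X) (hδ : 0 < δ) (N : ℝ)
    (a : Ideal GaussianInt → ℝ) :
    ∑ c ∈ puncturedDisc X, (discWeight N δ a c).toReal ≤
      X ^ 2 * (25 * (4 * (X * δ) + 1) ^ 2 * normSq a N) := by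
  rw [← ENNReal.toReal_sum fun c hc => discWeight_ne_top hX hδ N a hc]
  have hn := normSq_nonneg a N
  exact ENNReal.toReal_le_of_le_ofReal (by positivity) (sum_discWeight_le hX hδ N a)

theorem integral_sq_norm_expSum_le {X δ : ℝ} (hX : 0 < X) (hδ : 0 < δ) (N : ℝ)
    (a : Ideal GaussianInt → ℝ) {c : GaussianInt} (hc : c ∈ puncturedDisc X) (q : GaussianInt) :
    ∫ u in Metric.closedBall (0 : ℂ) δ, ‖expSum N a c q u‖ ^ 2 ≤
      9 * ‖GaussianInt.toComplex c‖ ^ 2 * (discWeight N δ a c).toReal := by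
  have h1 := ofReal_integral_sq_norm_expSum_le N δ a (mem_puncturedDisc.1 hc).2 q
  rw [← ENNReal.ofReal_toReal (discWeight_ne_top hX hδ N a hc),
    ← ENNReal.ofReal_mul (by positivity)] at h1
  exact (ENNReal.ofReal_le_ofReal_iff (by positivity)).1 h1

theorem majorant_nonneg (ε T N X : ℝ) (a : Ideal GaussianInt → ℝ) : 0 ≤ majorant ε T N X a :=
  Finset.sum_nonneg fun _ _ => mul_nonneg (by positivity) <| Finset.sum_nonneg fun _ _ =>
    mul_nonneg (by positivity) <| integral_nonneg fun _ => by positivity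

/-- The exponent 4ε is 2ε from the sum over q plus 2ε from the overlap factor (4Xδ + 1)² ≤ (5N^ε)²
with δ = N^ε / T. The factor 9|c|² from Cauchy-Schwarz cancels |c|⁻². -/
theorem exists_majorant_le {ε : ℝ} (hε : 0 < ε) (hε1 : ε ≤ 1) : ∃ C, 0 ≤ C ∧
    ∀ X T N : ℝ, 1 ≤ X → X ≤ T → T < N → ∀ a : Ideal GaussianInt → ℝ,
      majorant ε T N X a ≤ C * (X ^ 2 * N ^ (4 * ε) * normSq a N) := by
  obtain ⟨C, hC, hq⟩ := exists_sum_inv_sq_le hε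
  refine ⟨C * 9 * 25 * 5 ^ 2, by positivity, fun X T N hX hXT hTN a => ?_⟩
  have hN : 1 ≤ N := by linarith
  have hN0 : 0 < N := by linarith
  have hX0 : 0 < X := by linarith
  have hT0 : 0 < T := by linarith
  have hP1 : 1 ≤ N ^ ε := Real.one_le_rpow hN hε.le
  have hP0 : 0 < N ^ ε := by linarith
  have hδ : 0 < N ^ ε / T := by positivity
  have hn := normSq_nonneg a N
  have hXδ : X * (N ^ ε / T) ≤ N ^ ε := by
    rw [← mul_div_assoc, div_le_iff₀ hT0, mul_comm]
    gcongr
  have hterm : ∀ c ∈ puncturedDisc X, 1 / ‖GaussianInt.toComplex c‖ ^ 2 *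
      ∑ q ∈ puncturedDisc (‖GaussianInt.toComplex c‖ * N ^ ε),
        1 / ‖GaussianInt.toComplex q‖ ^ 2 *
          ∫ u in Metric.closedBall (0 : ℂ) (N ^ ε / T), ‖expSum N a c q u‖ ^ 2 ≤
      C * (N ^ ε) ^ 2 * 9 * (discWeight N (N ^ ε / T) a c).toReal := by
    intro c hc
    obtain ⟨hcX, hc0⟩ := mem_puncturedDisc.1 hc
    have hpos : 0 < ‖GaussianInt.toComplex c‖ := norm_pos_iff.2 (toComplex_ne_zero hc0)
    -- Here |c| ≤ X < N bounds the first factor by N^ε, and ε ≤ 1 bounds (N^ε)^ε by N^ε.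
    have hpow : (‖GaussianInt.toComplex c‖ * N ^ ε) ^ ε ≤ (N ^ ε) ^ 2 := by
      rw [Real.mul_rpow hpos.le hP0.le, sq]
      refine mul_le_mul (Real.rpow_le_rpow hpos.le (by linarith) hε.le) ?_ (by positivity) hP0.le
      exact (Real.rpow_le_rpow_of_exponent_le hP1 hε1).trans_eq
        (Real.rpow_one _)
    calc _ ≤ 1 / ‖GaussianInt.toComplex c‖ ^ 2 *
          ∑ q ∈ puncturedDisc (‖GaussianInt.toComplex c‖ * N ^ ε),
            1 / ‖GaussianInt.toComplex q‖ ^ 2 *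
              (9 * ‖GaussianInt.toComplex c‖ ^ 2 * (discWeight N (N ^ ε / T) a c).toReal) := by
          gcongr with q
          exact integral_sq_norm_expSum_le hX0 hδ N a hc q
      _ = (∑ q ∈ puncturedDisc (‖GaussianInt.toComplex c‖ * N ^ ε),
            1 / ‖GaussianInt.toComplex q‖ ^ 2) * 9 * (discWeight N (N ^ ε / T) a c).toReal := by
          rw [← Finset.sum_mul]
          field_simp
      _ ≤ _ := by
          gcongr
          exact (hq _ (by positivity)).trans (by gcongr)
  refine (Finset.sum_le_sum hterm).trans ?_
  rw [← Finset.mul_sum]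
  calc _ ≤ C * (N ^ ε) ^ 2 * 9 * (X ^ 2 * (25 * (5 * N ^ ε) ^ 2 * normSq a N)) := by
        refine mul_le_mul_of_nonneg_left
          ((sum_toReal_discWeight_le hX0 hδ N a).trans ?_) (by positivity)
        gcongr
        linarith
    _ = _ := by
        rw [mul_comm 4 ε, Real.rpow_mul hN0.le, show (4 : ℝ) = (4 : ℕ) by norm_num,
          Real.rpow_natCast]
        ring

/-- S itself does not depend on ε, so the truncation may be made with the smaller parameter κ =
min(ε, 1)/4, for which the loss N^(4κ) is at most N^ε. -/
theorem norm_S_le {η : ℝ → ℝ} (hη : IsCutoff η) {ε : ℝ} (hε : 0 < ε) : ∃ C, 0 ≤ C ∧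
    ∀ X T N : ℝ, 1 ≤ X → X ≤ T → T < N → ∀ a : Ideal GaussianInt → ℝ,
      ‖S η T N X a‖ ≤ C * (T ^ 4 * X ^ 2 * N ^ ε * normSq a N) := by
  set κ := min ε 1 / 4 with hκ
  have hκ0 : 0 < κ := by positivity
  have hκε : 4 * κ ≤ ε := by
    have := min_le_left ε 1
    linarith
  have hκ1 : κ ≤ 1 := by
    have := min_le_right ε 1
    linarith
  obtain ⟨C₁, hC₁, h1⟩ := norm_S_sub_S₀_le hη hκ0
  obtain ⟨C₂, hC₂, h2⟩ := norm_S₀_le hη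
  obtain ⟨C₃, hC₃, h3⟩ := exists_majorant_le hκ0 hκ1
  refine ⟨C₁ + C₂ * C₃, by positivity, fun X T N hX hXT hTN a => ?_⟩
  have hN : 1 ≤ N := by linarith
  have hT : 1 ≤ T := hX.trans hXT
  have hn := normSq_nonneg a N
  have h4 : 1 ≤ T ^ 4 * X ^ 2 * N ^ ε :=
    one_le_mul_of_one_le_of_one_le
      (one_le_mul_of_one_le_of_one_le (one_le_pow₀ hT) (one_le_pow₀ hX)) (Real.one_le_rpow hN hε.le)
  have h5 : N ^ (4 * κ) ≤ N ^ ε := Real.rpow_le_rpow_of_exponent_le hN hκε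
  have hT0 : 0 < T := by linarith
  have hN0 : 0 < N := by linarith
  calc ‖S η T N X a‖ = ‖(S η T N X a - S₀ η κ T N X a) + S₀ η κ T N X a‖ := by
        rw [sub_add_cancel]
    _ ≤ C₁ * normSq a N + C₂ * T ^ 4 * (C₃ * (X ^ 2 * N ^ ε * normSq a N)) := by
        refine (norm_add_le _ _).trans (add_le_add (h1 X T N hX hXT hTN a)
          ((h2 κ X T N hX hXT hTN a).trans ?_))
        refine mul_le_mul_of_nonneg_left ((h3 X T N hX hXT hTN a).trans ?_) (by positivity)
        gcongr
    _ ≤ C₁ * (T ^ 4 * X ^ 2 * N ^ ε * normSq a N) +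
          C₂ * T ^ 4 * (C₃ * (X ^ 2 * N ^ ε * normSq a N)) := by
        gcongr
        exact le_mul_of_one_le_left hn h4
    _ = _ := by ring

end DualSum

theorem proposition4 (η : ℝ → ℝ) (hη : DualSum.IsCutoff η) :
    -- the integrals and the series in the definitions converge absolutely
    (∀ T : ℝ, 1 ≤ T →
      (∀ w v : ℂ, MeasureTheory.Integrable (DualSum.fIntegrand η T w v)) ∧
      (∀ v : ℂ, v ≠ 0 → MeasureTheory.Integrable fun w : ℂ => DualSum.f η T w v) ∧
      (∀ m n c : GaussianInt, c ≠ 0 →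
        Summable fun q : {q : GaussianInt // q ≠ 0} => DualSum.dualTerm η T m n c q)) ∧
    ∀ ε : ℝ, 0 < ε → ∃ C : ℝ, 0 < C ∧
      ∀ X T N : ℝ, 1 ≤ X → X ≤ T → T < N → ∀ a : Ideal GaussianInt → ℝ,
        ‖DualSum.S η T N X a - DualSum.S₀ η ε T N X a‖ ≤ C * DualSum.normSq a N ∧
        ‖DualSum.S₀ η ε T N X a‖ ≤ C * (T ^ 4 * N ^ ε * DualSum.majorant ε T N X a) ∧
        ‖DualSum.S η T N X a‖ ≤ C * (T ^ 4 * X ^ 2 * N ^ ε * DualSum.normSq a N) := by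
  refine ⟨fun T hT => ⟨DualSum.integrable_fIntegrand hη T,
    fun v hv => DualSum.integrable_f hη (by linarith) hv,
    fun m n c hc => DualSum.summable_dualTerm hη hT m n hc⟩, fun ε hε => ?_⟩
  obtain ⟨C₁, hC₁, h1⟩ := DualSum.norm_S_sub_S₀_le hη hε
  obtain ⟨C₂, hC₂, h2⟩ := DualSum.norm_S₀_le hη
  obtain ⟨C₃, hC₃, h3⟩ := DualSum.norm_S_le hη hε
  refine ⟨C₁ + C₂ + C₃ + 1, by positivity, fun X T N hX hXT hTN a => ?_⟩
  have hN : 1 ≤ N := by linarith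
  have hT : 0 < T := by linarith
  have hn := DualSum.normSq_nonneg a N
  have hM := DualSum.majorant_nonneg ε T N X a
  have hP : 1 ≤ N ^ ε := Real.one_le_rpow hN hε.le
  refine ⟨(h1 X T N hX hXT hTN a).trans ?_, (h2 ε X T N hX hXT hTN a).trans ?_,
    (h3 X T N hX hXT hTN a).trans ?_⟩
  · gcongr
    linarith
  · rw [mul_assoc]
    -- The estimate for S₀ holds without the factor N^ε, which is at least 1.
    have h4 : T ^ 4 ≤ T ^ 4 * N ^ ε := le_mul_of_one_le_right (by positivity) hP
    gcongr
    linarith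
  · gcongr
    linarith
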